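/- By a rational function we mean an element $A\in\mathbb C(z)$; its degree is the maximum of the degrees of its numerator and denominator in lowest terms, and Möbius transformations are the rational functions of degree one. The set $V(A)\subset\mathbb{CP}^1$ of critical values is the image of the set of points of $\mathbb{CP}^1$ at which $A$ has multiplicity at least two. A rational function of degree at least two is indecomposable if, whenever it equals $B\circ C$ with $B,C$ rational functions, $B$ or $C$ has degree one. Two decompositions $A_r\circ\dots\circ A_1$ and $B_\ell\circ\dots\circ B_1$ of the same function are equivalent if $\ell=r$ and there are Möbius transformations $\mu_0=\mathrm{id},\mu_1,\dots,\mu_{r-1},\mu_r=\mathrm{id}$ with $A_i=\mu_i^{-1}\circ B_i\circ\mu_{i-1}$ for $1\le i\le r$. The iterates of $A$ admit no non-trivial decompositions if, for every $n\ge1$, every decomposition of $A^{\circ n}$ into a composition of indecomposable rational functions is equivalent to the decomposition $A\circ\dots\circ A$ ($n$ factors). Finally, $\mathrm{Rat}_2\subset\mathbb{CP}^5$ denotes the complement of the hypersurface $\mathrm{Res}_{2,2}(P,Q)=0$ in the space of pairs $(P,Q)\neq(0,0)$ of polynomials of degree at most two up to common scaling; its points are identified with the rational functions $P/Q$ of degree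 two. **Theorem.** 1. For every rational function $A$ of degree two there is exactly one Möbius transformation $\mu_A\ne\mathrm{id}$ with $A\circ\mu_A=A$, and $\mu_A\circ\mu_A=\mathrm{id}$. 2. If $A$ is a rational function of degree two with $\mu_A(V(A))\cap V(A)=\emptyset$, then the iterates of $A$ admit no non-trivial decompositions. 3. There is a non-empty Zariski open subset $U\subset\mathrm{Rat}_2$ such that every $A\in U$ satisfies $\mu_A(V(A))\cap V(A)=\emptyset$; consequently, for every $A\in U$ the iterates of $A$ admit no non-trivial decompositions. -/

import Mathlib

noncomputable section

namespace RationalMap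

open Polynomial

/-- The degree of a rational function over `ℂ`, written in lowest terms: the maximum of the degrees
of its numerator and denominator. Nonzero exactly for non-constant functions. -/
def degree (A : RatFunc ℂ) : ℕ := max A.num.natDegree A.denom.natDegree

/-- The composition `B ∘ C` of rational functions, that is, `C` substituted for the variable of `B`.
(It can take a junk value only if `C` is a constant that is a pole of `B`, and is then constant.) -/
def comp (B C : RatFunc ℂ) : RatFunc ℂ := B.eval RatFunc.C C

/-- The `n`-th iterate `A ∘ ⋯ ∘ A`; the zeroth iterate is the identity `z`. -/
def iter (A : RatFunc ℂ) (n : ℕ) : RatFunc ℂ := (comp A)^[n] RatFunc.X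

/-- A rational function of degree at least two is indecomposable if in every representation of it
as a composition of two rational functions one of the two has degree one. -/
def Indecomposable (A : RatFunc ℂ) : Prop :=
  2 ≤ degree A ∧ ∀ B C : RatFunc ℂ, A = comp B C → degree B = 1 ∨ degree C = 1

/-- `compList [A₁, A₂, …, Aᵣ] = Aᵣ ∘ ⋯ ∘ A₂ ∘ A₁` (the head of the list is applied first). -/
def compList : List (RatFunc ℂ) → RatFunc ℂ
  | [] => RatFunc.X
  | A :: L => comp (compList L) A

/-- Two Möbius transformations, as rational functions, are inverse to each other. -/
def MobiusInverse (μ ν : RatFunc ℂ) : Prop :=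
  degree μ = 1 ∧ degree ν = 1 ∧ comp μ ν = RatFunc.X ∧ comp ν μ = RatFunc.X

/-- Equivalence of the decompositions `Aᵣ ∘ ⋯ ∘ A₁` and `Bᵣ ∘ ⋯ ∘ B₁`, given as the lists
`L = [A₁, …, Aᵣ]` and `M = [B₁, …, Bᵣ]`: they have equal length, and there are Möbius
transformations `μ₀ = id, μ₁, …, μᵣ₋₁, μᵣ = id` with `Aᵢ = μᵢ⁻¹ ∘ Bᵢ ∘ μᵢ₋₁` for `1 ≤ i ≤ r`.
So `A₁ = μ₁⁻¹ ∘ B₁` and `Aᵣ = Bᵣ ∘ μᵣ₋₁` if `r ≥ 2`, and `A₁ = B₁` if `r = 1`. Here `ν i` is the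
inverse of `μ i`, and the list entry with index `i` is the factor number `i + 1`. -/
def DecompEquiv (L M : List (RatFunc ℂ)) : Prop :=
  ∃ h : L.length = M.length, ∃ μ ν : ℕ → RatFunc ℂ,
    (∀ i, MobiusInverse (μ i) (ν i)) ∧ μ 0 = RatFunc.X ∧ μ L.length = RatFunc.X ∧
    ∀ (i : ℕ) (hi : i < L.length),
      L[i] = comp (ν (i + 1)) (comp (M[i]'(h ▸ hi)) (μ i))

/-- The iterates of `A` admit no non-trivial decompositions: for every `n ≥ 1`, each decomposition
of the `n`-th iterate into indecomposable functions is equivalent to `A ∘ ⋯ ∘ A`. -/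
def NoNontrivialDecomp (A : RatFunc ℂ) : Prop :=
  ∀ n : ℕ, 1 ≤ n → ∀ L : List (RatFunc ℂ), (∀ B ∈ L, Indecomposable B) →
    compList L = iter A n → DecompEquiv L (List.replicate n A)

open Classical in
/-- The self-map of the Riemann sphere `ℂ ∪ {∞}` given by a rational function. -/
def toMap (A : RatFunc ℂ) : OnePoint ℂ → OnePoint ℂ
  | some z => if A.denom.eval z = 0 then OnePoint.infty
      else ((A.num.eval z / A.denom.eval z : ℂ) : OnePoint ℂ)
  | none => if A.denom.coeff (degree A) = 0 then OnePoint.infty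
      else ((A.num.coeff (degree A) / A.denom.coeff (degree A) : ℂ) : OnePoint ℂ)

/-- For `A = P / Q` in lowest terms, the polynomial `P - w Q` (for `w = ∞`, the polynomial `Q`),
whose roots are the finite points of the fibre of `A` over `w`. -/
def fiberPoly (A : RatFunc ℂ) : OnePoint ℂ → ℂ[X]
  | some w => A.num - C w * A.denom
  | none => A.denom

/-- The multiplicity (local degree) of `A` at a point of the sphere. At `∞` it is the order of
vanishing at `∞` of the fibre polynomial through `∞`, viewed as a form of degree `degree A`. -/
def mult (A : RatFunc ℂ) : OnePoint ℂ → ℕ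
  | some z => (fiberPoly A (toMap A (z : OnePoint ℂ))).rootMultiplicity z
  | none => degree A - (fiberPoly A (toMap A OnePoint.infty)).natDegree

/-- The set `V(A)` of critical values in the sphere: the images of the critical points, which are
the points of multiplicity at least two. -/
def criticalValues (A : RatFunc ℂ) : Set (OnePoint ℂ) :=
  toMap A '' {z | 2 ≤ mult A z}

/-- `μ` is a Möbius transformation other than the identity with `A ∘ μ = A`. -/
def IsDeck (A μ : RatFunc ℂ) : Prop :=
  degree μ = 1 ∧ μ ≠ RatFunc.X ∧ comp A μ = A

/-- The space `ℂℙ^(2m+1)` of pairs of polynomials `(P, Q)` of degree at most `m`, not both zero, up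
to scaling. Homogeneous coordinates: `(0, k)` for the coefficient of `z ^ k` in `P`, and `(1, k)` for
that in `Q`. -/
abbrev CoeffSpace (m : ℕ) : Type :=
  Projectivization ℂ (Fin 2 × Fin (m + 1) → ℂ)

/-- The polynomial with coefficients `v (j, 0), …, v (j, m)`. -/
def coeffPoly {m : ℕ} (v : Fin 2 × Fin (m + 1) → ℂ) (j : Fin 2) : ℂ[X] :=
  ∑ k : Fin (m + 1), C (v (j, k)) * X ^ (k : ℕ)

/-- The variety `Rat_m` (for `m ≥ 1`): the complement in `ℂℙ^(2m+1)` of the resultant hypersurface. -/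
def RatVar (m : ℕ) : Set (CoeffSpace m) :=
  {x | resultant (coeffPoly x.rep 0) (coeffPoly x.rep 1) m m ≠ 0}

/-- The rational function `P / Q` given by a point of `ℂℙ^(2m+1)`. -/
def toRatFunc {m : ℕ} (x : CoeffSpace m) : RatFunc ℂ :=
  algebraMap ℂ[X] (RatFunc ℂ) (coeffPoly x.rep 0) / algebraMap ℂ[X] (RatFunc ℂ) (coeffPoly x.rep 1)

/-- The common zero set in `ℂℙ^(2m+1)` of a set of polynomials (used for homogeneous ones). -/
def projZeros {m : ℕ} (S : Set (MvPolynomial (Fin 2 × Fin (m + 1)) ℂ)) : Set (CoeffSpace m) :=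
  {x | ∀ p ∈ S, MvPolynomial.eval x.rep p = 0}

/-- `U` is a Zariski open subset of `Rat_m`: its complement in `Rat_m` is cut out by homogeneous
polynomials. -/
def IsZariskiOpenInRatVar {m : ℕ} (U : Set (CoeffSpace m)) : Prop :=
  ∃ S : Set (MvPolynomial (Fin 2 × Fin (m + 1)) ℂ),
    (∀ p ∈ S, ∃ d : ℕ, p.IsHomogeneous d) ∧ U = RatVar m \ projZeros S

end RationalMap

end

noncomputable section

namespace RationalMap

open Polynomial

/-! A quadratic `A` is `M ∘ β²` with `M`, `β` Möbius: the two quadratic forms are simultaneously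
diagonalized by the squares of the factors of their Jacobian (`exists_squareForm`). From `A ∘ μ = A`
follows `β ∘ μ = ±β`, so the only deck transformation is `μ = β⁻¹ ∘ (-β)`.

Let `N = β ∘ M` have matrix `(x, y; z, w)`. The critical values are `M(∞)` and `M(0)`, and `β` sends
them to `x/z` and `y/w`. Since `μ` becomes negation in the coordinate `β`, disjointness of `V(A)`
and `μ(V(A))` says exactly that `x, y, z, w` and `xw + yz` are nonzero. Under these conditions the
curve `A(v) = μ(A(u))`, that is `N(p²) = -N(q²)`, has genus one, so it has no non-constant rational
parametrization; a Wronskian degree count proves this.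

Decompositions are controlled by intermediate fields. Suppose `L` contains `A(w)` but not `w`, where
`w = A^{∘(n+1)}`. Then `L(w)` is quadratic over `L`, and its conjugation sends `w` to `μ(w)`. If `u
= A^{∘n}` were in `L(w)`, its conjugate `v` would satisfy `A(v) = μ(A(u))`, which is impossible. By
induction `L(w) = ℂ(w)`, and invariance under `μ` gives `L = ℂ(A(w))` (`eq_adjoin_iter`). Every
field containing an iterate of `A` is thus generated by an iterate, and factors `A` can be split off
one at a time (`decomposition_iter`).

Genericity is the nonvanishing of two explicit invariants of the coefficients, both nonzero at one
sample function. -/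

/-! ### Composition, degree and subfields of `ℂ(z)` -/

theorem degree_eq_zero_iff {T : RatFunc ℂ} : degree T = 0 ↔ ∃ c, T = RatFunc.C c := by
  rw [degree, Nat.max_eq_zero_iff, RatFunc.eq_C_iff]

theorem transcendental_of_degree_ne_zero {T : RatFunc ℂ} (hT : degree T ≠ 0) :
    Transcendental ℂ T :=
  RatFunc.transcendental_of_ne_C T (mt degree_eq_zero_iff.2 hT)

/-- Substitution of a non-constant rational function, as an algebra homomorphism. -/
def compHom (T : RatFunc ℂ) (hT : degree T ≠ 0) : RatFunc ℂ →ₐ[ℂ] RatFunc ℂ :=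
  RatFunc.liftAlgHom (aeval T) (nonZeroDivisors_le_comap_nonZeroDivisors_of_injective _
    (transcendental_iff_injective.1 (transcendental_of_degree_ne_zero hT)))

theorem comp_eq_aeval (B T : RatFunc ℂ) : comp B T = aeval T B.num / aeval T B.denom := rfl

theorem comp_eq_compHom (B : RatFunc ℂ) {T : RatFunc ℂ} (hT : degree T ≠ 0) :
    comp B T = compHom T hT B := by
  rw [compHom, RatFunc.liftAlgHom_apply, comp_eq_aeval]

theorem comp_X (B : RatFunc ℂ) : comp B RatFunc.X = B := by
  rw [comp_eq_aeval, RatFunc.aeval_X_left_eq_algebraMap, RatFunc.aeval_X_left_eq_algebraMap,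
    RatFunc.num_div_denom]

theorem X_comp (T : RatFunc ℂ) : comp RatFunc.X T = T := by
  simp [comp]

theorem degree_X : degree (RatFunc.X : RatFunc ℂ) = 1 := by
  simp [degree]

theorem comp_right_injective {T : RatFunc ℂ} (hT : degree T ≠ 0) :
    Function.Injective fun B => comp B T := by
  intro B C h
  simp only [comp_eq_compHom _ hT] at h
  exact (compHom T hT).toRingHom.injective h

/-- Algebra homomorphisms between fields commute with the evaluation of rational functions. -/
theorem map_comp_of_mem {F : IntermediateField ℂ (RatFunc ℂ)} (τ : F →ₐ[ℂ] RatFunc ℂ) (S : RatFunc ℂ)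
    (f g : F) (h : (g : RatFunc ℂ) = comp S f) : τ g = comp S (τ f) := by
  have hg : g = aeval f S.num / aeval f S.denom := by
    apply Subtype.ext
    rw [h, comp_eq_aeval]
    push_cast
    have h1 := aeval_algHom_apply F.val f S.num
    have h2 := aeval_algHom_apply F.val f S.denom
    simp only [IntermediateField.coe_val] at h1 h2
    rw [h1, h2]
  rw [hg, map_div₀, comp_eq_aeval, aeval_algHom_apply, aeval_algHom_apply]

theorem compHom_comp (S f : RatFunc ℂ) {T : RatFunc ℂ} (hT : degree T ≠ 0) :
    compHom T hT (comp S f) = comp S (compHom T hT f) := by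
  rw [comp_eq_aeval, map_div₀, comp_eq_aeval, aeval_algHom_apply, aeval_algHom_apply]

/-- Only the innermost function has to be non-constant: its substitution is a field homomorphism,
which respects the evaluation of `A`, including any division by zero. -/
theorem comp_assoc (A B : RatFunc ℂ) {T : RatFunc ℂ} (hT : degree T ≠ 0) :
    comp (comp A B) T = comp A (comp B T) := by
  rw [comp_eq_compHom _ hT, compHom_comp, comp_eq_compHom B hT]

theorem degree_comp_ne_zero {B T : RatFunc ℂ} (hB : degree B ≠ 0) (hT : degree T ≠ 0) :
    degree (comp B T) ≠ 0 := by
  intro h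
  obtain ⟨c, hc⟩ := degree_eq_zero_iff.1 h
  refine hB (degree_eq_zero_iff.2 ⟨c, comp_right_injective hT ?_⟩)
  simp only [hc]
  simp [comp]

theorem mem_adjoin_iff {f T : RatFunc ℂ} :
    f ∈ IntermediateField.adjoin ℂ {T} ↔ ∃ S, f = comp S T := by
  rw [IntermediateField.mem_adjoin_simple_iff]
  constructor
  · rintro ⟨r, s, rfl⟩
    by_cases hT : degree T = 0
    · obtain ⟨c, rfl⟩ := degree_eq_zero_iff.1 hT
      refine ⟨RatFunc.C (r.eval c / s.eval c), ?_⟩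
      have h (p : ℂ[X]) : aeval (RatFunc.C c) p = RatFunc.C (p.eval c) := by
        rw [← RatFunc.algebraMap_eq_C, aeval_algebraMap_apply_eq_algebraMap_eval]
      rw [h, h, ← map_div₀, comp, RatFunc.eval_C]
    · refine ⟨algebraMap _ _ r / algebraMap _ _ s, ?_⟩
      rw [comp_eq_compHom _ hT, compHom, RatFunc.liftAlgHom_apply_div]
  · rintro ⟨S, rfl⟩
    exact ⟨S.num, S.denom, rfl⟩

theorem comp_mem (S : RatFunc ℂ) {L : IntermediateField ℂ (RatFunc ℂ)} {T : RatFunc ℂ}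
    (h : T ∈ L) : comp S T ∈ L :=
  IntermediateField.adjoin_simple_le_iff.2 h (mem_adjoin_iff.2 ⟨S, rfl⟩)

theorem degree_eq_finrank (T : RatFunc ℂ) :
    degree T = Module.finrank (IntermediateField.adjoin ℂ {T}) (RatFunc ℂ) :=
  (RatFunc.finrank_eq_max_natDegree T).symm

theorem eq_top_of_X_mem {L : IntermediateField ℂ (RatFunc ℂ)} (h : RatFunc.X ∈ L) : L = ⊤ := by
  rw [eq_top_iff, ← RatFunc.adjoin_X]
  exact IntermediateField.adjoin_simple_le_iff.2 h

theorem degree_eq_one_iff {T : RatFunc ℂ} : degree T = 1 ↔ ∃ S, comp S T = RatFunc.X := by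
  rw [degree_eq_finrank, IntermediateField.finrank_eq_one_iff_eq_top]
  constructor
  · intro h
    obtain ⟨S, hS⟩ := mem_adjoin_iff.1 (h ▸ IntermediateField.mem_top :
      RatFunc.X ∈ IntermediateField.adjoin ℂ {T})
    exact ⟨S, hS.symm⟩
  · rintro ⟨S, hS⟩
    exact eq_top_of_X_mem (mem_adjoin_iff.2 ⟨S, hS.symm⟩)

theorem exists_mobiusInverse {T : RatFunc ℂ} (hT : degree T = 1) : ∃ S, MobiusInverse T S := by
  obtain ⟨S, hS⟩ := degree_eq_one_iff.1 hT
  have hT0 : degree T ≠ 0 := by omega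
  have hS0 : degree S ≠ 0 := by
    intro h
    obtain ⟨c, rfl⟩ := degree_eq_zero_iff.1 h
    have h1 : (RatFunc.C c : RatFunc ℂ) = RatFunc.X := by
      rw [← hS]; simp [comp]
    have := degree_X
    rw [← h1, degree_eq_zero_iff.2 ⟨c, rfl⟩] at this
    omega
  have hTS : comp T S = RatFunc.X := by
    apply comp_right_injective hT0
    simp only [comp_assoc _ _ hT0, hS, comp_X, X_comp]
  exact ⟨S, hT, degree_eq_one_iff.2 ⟨T, hTS⟩, hTS, hS⟩

theorem MobiusInverse.symm {μ ν : RatFunc ℂ} (h : MobiusInverse μ ν) : MobiusInverse ν μ :=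
  ⟨h.2.1, h.1, h.2.2.2, h.2.2.1⟩

theorem mobiusInverse_X : MobiusInverse RatFunc.X RatFunc.X :=
  ⟨degree_X, degree_X, comp_X _, comp_X _⟩

theorem MobiusInverse.degree_ne_zero {μ ν : RatFunc ℂ} (h : MobiusInverse μ ν) : degree μ ≠ 0 := by
  rw [h.1]; exact one_ne_zero

theorem MobiusInverse.comp_cancel {μ ν : RatFunc ℂ} (h : MobiusInverse μ ν) {T : RatFunc ℂ}
    (hT : degree T ≠ 0) : comp μ (comp ν T) = T := by
  rw [← comp_assoc _ _ hT, h.2.2.1, X_comp]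

theorem MobiusInverse.cancel_comp {μ ν : RatFunc ℂ} (h : MobiusInverse μ ν) (T : RatFunc ℂ) :
    comp (comp T μ) ν = T := by
  rw [comp_assoc _ _ h.symm.degree_ne_zero, h.2.2.1, comp_X]

theorem iter_zero (A : RatFunc ℂ) : iter A 0 = RatFunc.X := rfl

theorem iter_succ (A : RatFunc ℂ) (n : ℕ) : iter A (n + 1) = comp A (iter A n) := by
  simp only [iter, Function.iterate_succ_apply']

theorem degree_iter_ne_zero {A : RatFunc ℂ} (hA : degree A ≠ 0) (n : ℕ) :
    degree (iter A n) ≠ 0 := by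
  induction n with
  | zero => rw [iter_zero, degree_X]; exact one_ne_zero
  | succ n ih => rw [iter_succ]; exact degree_comp_ne_zero hA ih

theorem iter_succ' {A : RatFunc ℂ} (hA : degree A ≠ 0) (n : ℕ) :
    iter A (n + 1) = comp (iter A n) A := by
  induction n with
  | zero => rw [iter_succ, iter_zero, comp_X, X_comp]
  | succ n ih => rw [iter_succ, ih, ← comp_assoc _ _ hA, ← iter_succ, ih]

/-! ### Wronskians and a curve of genus one -/

/-- `G` and its derivative are both divisible by `u`, and `H` and its derivative by `t`. -/
theorem mul_dvd_wronskian_of_sq_dvd {G H u t : ℂ[X]} (hG : u ^ 2 ∣ G) (hH : t ^ 2 ∣ H) :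
    u * t ∣ wronskian G H := by
  obtain ⟨x, rfl⟩ := hG
  obtain ⟨y, rfl⟩ := hH
  refine ⟨u * t * (x * derivative y - derivative x * y) + 2 * x * y * (u * derivative t
    - derivative u * t), ?_⟩
  simp only [wronskian, sq, derivative_mul]
  ring

/-- The Wronskian is bilinear and alternating, so the determinant of the combination factors out,
and `W(r², s²) = 2 r s W(r, s)`. -/
theorem wronskian_sq_combination (r s : ℂ[X]) (α β γ : ℂ) :
    wronskian (C α * r ^ 2 + C β * s ^ 2) (C β * r ^ 2 + C γ * s ^ 2) =
      C (2 * (α * γ - β ^ 2)) * (r * s * wronskian r s) := by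
  simp only [wronskian, sq, derivative_mul, derivative_add, derivative_C, map_mul, map_sub,
    map_ofNat]
  ring

theorem isCoprime_sq_combination {r s : ℂ[X]} (hrs : IsCoprime r s) {α β γ δ : ℂ}
    (h : α * δ - β * γ ≠ 0) :
    IsCoprime (C α * r ^ 2 + C β * s ^ 2) (C γ * r ^ 2 + C δ * s ^ 2) := by
  obtain ⟨x, y, hxy⟩ := hrs.pow (m := 2) (n := 2)
  have hk : C ((α * δ - β * γ)⁻¹) * (C α * C δ - C β * C γ) = 1 := by
    rw [← C_mul, ← C_mul, ← C_sub, ← C_mul, inv_mul_cancel₀ h, C_1]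
  refine ⟨C ((α * δ - β * γ)⁻¹) * (x * C δ - y * C γ),
    C ((α * δ - β * γ)⁻¹) * (y * C α - x * C β), ?_⟩
  linear_combination hxy + (x * r ^ 2 + y * s ^ 2) * hk

theorem isCoprime_mul_of_dvd_sq_combination {r s u : ℂ[X]} (hrs : IsCoprime r s) {α β : ℂ}
    (hα : α ≠ 0) (hβ : β ≠ 0) (hu : u ∣ C α * r ^ 2 + C β * s ^ 2) : IsCoprime u (r * s) := by
  have key : ∀ {r s : ℂ[X]} {α β : ℂ}, IsCoprime r s → β ≠ 0 →
      IsCoprime (C α * r ^ 2 + C β * s ^ 2) r := by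
    intro r s α β hrs hβ
    have h1 : IsCoprime (C β * s ^ 2) r :=
      (isCoprime_mul_unit_left_left (isUnit_C.2 hβ.isUnit) _ _).2 hrs.symm.pow_left
    rw [show C α * r ^ 2 + C β * s ^ 2 = C β * s ^ 2 + C α * r * r by ring]
    exact h1.add_mul_right_left _
  refine IsCoprime.of_isCoprime_of_dvd_left (IsCoprime.mul_right (key hrs hβ) ?_) hu
  rw [add_comm]
  exact key hrs.symm hα

/-- The elliptic curve `α p² q² + β (p² + q²) + γ = 0` has no non-constant solution `p = t / u`,
`q = r / s`. -/
theorem natDegree_eq_zero_of_biquadratic {r s t u : ℂ[X]} (hrs : IsCoprime r s)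
    (htu : IsCoprime t u) {α β γ : ℂ} (hα : α ≠ 0) (hβ : β ≠ 0) (hγ : γ ≠ 0)
    (hd : α * γ - β ^ 2 ≠ 0)
    (h : t ^ 2 * (C α * r ^ 2 + C β * s ^ 2) = - (u ^ 2 * (C β * r ^ 2 + C γ * s ^ 2))) :
    r.natDegree = 0 ∧ s.natDegree = 0 := by
  by_contra hcon
  have hw : wronskian r s ≠ 0 := by
    intro h0
    obtain ⟨h1, h2⟩ := hrs.wronskian_eq_zero_iff.1 h0
    exact hcon ⟨derivative_eq_zero.1 h1, derivative_eq_zero.1 h2⟩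
  have hr : r ≠ 0 := by rintro rfl; simp at hw
  have hs : s ≠ 0 := by rintro rfl; simp at hw
  have hGH := isCoprime_sq_combination hrs (α := α) (β := β) (γ := β) (δ := γ) (by rwa [← sq])
  have hWr := wronskian_sq_combination r s α β γ
  set G := C α * r ^ 2 + C β * s ^ 2 with hG
  set H := C β * r ^ 2 + C γ * s ^ 2 with hH
  have hne : wronskian G H ≠ 0 := by
    rw [hWr]
    exact mul_ne_zero (C_ne_zero.2 (mul_ne_zero two_ne_zero hd)) (mul_ne_zero (mul_ne_zero hr hs) hw)
  have hG0 : G ≠ 0 := by intro h0; rw [h0] at hne; simp at hne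
  have hH0 : H ≠ 0 := by intro h0; rw [h0] at hne; simp at hne
  -- Both sides of `t² G = -u² H` are products of coprime factors, so `G` is associated to `u²` and
  -- `H` to `t²`.
  have huG : u ^ 2 ∣ G := (htu.symm.pow (m := 2) (n := 2)).dvd_of_dvd_mul_left ⟨-H, by rw [h]; ring⟩
  have htH : t ^ 2 ∣ H := (htu.pow (m := 2) (n := 2)).dvd_of_dvd_mul_left ⟨-G, by linear_combination h⟩
  have hGu : G ∣ u ^ 2 := hGH.dvd_of_dvd_mul_right ⟨-t ^ 2, by linear_combination h⟩
  have hHt : H ∣ t ^ 2 := hGH.symm.dvd_of_dvd_mul_right ⟨-u ^ 2, by linear_combination h⟩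
  have hu0 : u ^ 2 ≠ 0 := by intro h0; rw [h0, zero_dvd_iff] at huG; exact hG0 huG
  have ht0 : t ^ 2 ≠ 0 := by intro h0; rw [h0, zero_dvd_iff] at htH; exact hH0 htH
  have dG : G.natDegree ≤ 2 * u.natDegree := by
    rw [← natDegree_pow]; exact natDegree_le_of_dvd hGu hu0
  have dH : H.natDegree ≤ 2 * t.natDegree := by
    rw [← natDegree_pow]; exact natDegree_le_of_dvd hHt ht0
  have cu : IsCoprime u (r * s) :=
    isCoprime_mul_of_dvd_sq_combination hrs hα hβ ((dvd_pow_self u two_ne_zero).trans huG)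
  have ct : IsCoprime t (r * s) :=
    isCoprime_mul_of_dvd_sq_combination hrs hβ hγ ((dvd_pow_self t two_ne_zero).trans htH)
  have hdvd : u * t ∣ wronskian r s := by
    have h1 := mul_dvd_wronskian_of_sq_dvd huG htH
    rw [hWr] at h1
    have h2 := (isUnit_C.2 (mul_ne_zero two_ne_zero hd).isUnit).dvd_mul_left.1 h1
    exact (IsCoprime.mul_left cu ct).dvd_of_dvd_mul_left h2
  have hu : u ≠ 0 := by rintro rfl; simp at hu0
  have ht : t ≠ 0 := by rintro rfl; simp at ht0
  -- The degrees collide: `deg r + deg s + deg W(r, s) < deg G + deg H ≤ 2 (deg u + deg t) ≤ 2 deg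
  -- W(r, s)`, whereas `deg W(r, s) < deg r + deg s`.
  have d1 := natDegree_le_of_dvd hdvd hw
  rw [natDegree_mul hu ht] at d1
  have d2 := natDegree_wronskian_lt_add hw
  have d3 := natDegree_wronskian_lt_add hne
  rw [hWr, natDegree_C_mul (mul_ne_zero two_ne_zero hd), natDegree_mul (mul_ne_zero hr hs) hw,
    natDegree_mul hr hs] at d3
  omega

theorem degree_eq_zero_of_biquadratic {p q : RatFunc ℂ} {α β γ : ℂ} (hα : α ≠ 0) (hβ : β ≠ 0)
    (hγ : γ ≠ 0) (hd : α * γ - β ^ 2 ≠ 0)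
    (h : RatFunc.C α * p ^ 2 * q ^ 2 + RatFunc.C β * (p ^ 2 + q ^ 2) + RatFunc.C γ = 0) :
    degree q = 0 := by
  have hp := RatFunc.num_div_denom p
  have hq := RatFunc.num_div_denom q
  have hp0 := RatFunc.algebraMap_ne_zero p.denom_ne_zero
  have hq0 := RatFunc.algebraMap_ne_zero q.denom_ne_zero
  rw [div_eq_iff hp0] at hp
  rw [div_eq_iff hq0] at hq
  have := natDegree_eq_zero_of_biquadratic q.isCoprime_num_denom p.isCoprime_num_denom hα hβ hγ hd
    (by
      apply RatFunc.algebraMap_injective ℂ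
      simp only [map_mul, map_add, map_neg, map_pow, hp, hq, RatFunc.algebraMap_C]
      linear_combination (algebraMap ℂ[X] (RatFunc ℂ) p.denom) ^ 2
        * (algebraMap ℂ[X] (RatFunc ℂ) q.denom) ^ 2 * h)
  simp [degree, this]

/-! ### Non-constant functions and Möbius transformations as matrices -/

theorem degree_ne_zero_of_transcendental {T : RatFunc ℂ} (hT : Transcendental ℂ T) :
    degree T ≠ 0 := by
  intro h
  obtain ⟨c, rfl⟩ := degree_eq_zero_iff.1 h
  exact hT (isAlgebraic_algebraMap c)

theorem degree_sq_ne_zero {T : RatFunc ℂ} (hT : degree T ≠ 0) : degree (T ^ 2) ≠ 0 :=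
  degree_ne_zero_of_transcendental ((transcendental_of_degree_ne_zero hT).pow two_pos)

theorem degree_neg_ne_zero {T : RatFunc ℂ} (hT : degree T ≠ 0) : degree (-T) ≠ 0 := by
  intro h
  obtain ⟨c, hc⟩ := degree_eq_zero_iff.1 h
  exact hT (degree_eq_zero_iff.2 ⟨-c, by rw [map_neg, ← hc, neg_neg]⟩)

theorem ne_zero_of_degree_ne_zero {T : RatFunc ℂ} (hT : degree T ≠ 0) : T ≠ 0 := by
  rintro rfl
  exact hT (degree_eq_zero_iff.2 ⟨0, (map_zero _).symm⟩)

theorem neg_ne_self_of_degree_ne_zero {T : RatFunc ℂ} (hT : degree T ≠ 0) : -T ≠ T := by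
  intro h
  exact ne_zero_of_degree_ne_zero hT (CharZero.neg_eq_self_iff.1 h)

theorem sq_comp (S : RatFunc ℂ) {T : RatFunc ℂ} (hT : degree T ≠ 0) :
    comp (S ^ 2) T = comp S T ^ 2 := by
  rw [comp_eq_compHom _ hT, comp_eq_compHom _ hT, map_pow]

theorem neg_comp (S : RatFunc ℂ) {T : RatFunc ℂ} (hT : degree T ≠ 0) :
    comp (-S) T = -comp S T := by
  rw [comp_eq_compHom _ hT, comp_eq_compHom _ hT, map_neg]

/-- The rational function `(a z + b) / (c z + d)`. -/
def mob (a b c d : ℂ) : RatFunc ℂ :=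
  (RatFunc.C a * RatFunc.X + RatFunc.C b) / (RatFunc.C c * RatFunc.X + RatFunc.C d)

theorem linear_ne_zero {T : RatFunc ℂ} (hT : degree T ≠ 0) {c d : ℂ} (h : c ≠ 0 ∨ d ≠ 0) :
    RatFunc.C c * T + RatFunc.C d ≠ 0 := by
  intro h0
  by_cases hc : c = 0
  · subst hc
    simp only [map_zero, zero_mul, zero_add, map_eq_zero] at h0
    simp [h0] at h
  · refine hT (degree_eq_zero_iff.2 ⟨-(d / c), ?_⟩)
    have hc' : (RatFunc.C c : RatFunc ℂ) ≠ 0 := (_root_.map_ne_zero _).2 hc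
    rw [map_neg, map_div₀]
    field_simp
    linear_combination h0

theorem right_ne_zero_of_det {a b c d : ℂ} (h : a * d - b * c ≠ 0) : c ≠ 0 ∨ d ≠ 0 := by
  by_contra hcon
  push Not at hcon
  simp [hcon] at h

theorem mob_comp (a b c d : ℂ) {T : RatFunc ℂ} (hT : degree T ≠ 0) :
    comp (mob a b c d) T = (RatFunc.C a * T + RatFunc.C b) / (RatFunc.C c * T + RatFunc.C d) := by
  rw [comp_eq_compHom _ hT, mob]
  have hX : compHom T hT RatFunc.X = T := by rw [← comp_eq_compHom, X_comp]
  have hC (x : ℂ) : compHom T hT (RatFunc.C x) = RatFunc.C x := (compHom T hT).commutes x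
  simp only [map_div₀, map_add, map_mul, hX, hC]

theorem degree_mob_ne_zero {a b c d : ℂ} (h : a * d - b * c ≠ 0) : degree (mob a b c d) ≠ 0 := by
  have hX : degree (RatFunc.X : RatFunc ℂ) ≠ 0 := by rw [degree_X]; exact one_ne_zero
  intro h0
  obtain ⟨k, hk⟩ := degree_eq_zero_iff.1 h0
  rw [mob, div_eq_iff (linear_ne_zero hX (right_ne_zero_of_det h))] at hk
  have hk' : RatFunc.C (a - k * c) * RatFunc.X + RatFunc.C (b - k * d) = 0 := by
    simp only [map_sub, map_mul]
    linear_combination hk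
  refine linear_ne_zero hX ?_ hk'
  by_contra hcon
  push Not at hcon
  apply h
  linear_combination d * hcon.1 - c * hcon.2

theorem mobius_div {K : Type*} [Field K] (a b c d N : K) {D : K} (hD : D ≠ 0) :
    (a * (N / D) + b) / (c * (N / D) + d) = (a * N + b * D) / (c * N + d * D) := by
  rw [← mul_div_mul_right (a * (N / D) + b) (c * (N / D) + d) hD]
  congr 1 <;> field_simp

theorem mob_comp_mob (a b c d : ℂ) {a' b' c' d' : ℂ} (h : a' * d' - b' * c' ≠ 0) :
    comp (mob a b c d) (mob a' b' c' d') =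
      mob (a * a' + b * c') (a * b' + b * d') (c * a' + d * c') (c * b' + d * d') := by
  have hX : degree (RatFunc.X : RatFunc ℂ) ≠ 0 := by rw [degree_X]; exact one_ne_zero
  rw [mob_comp _ _ _ _ (degree_mob_ne_zero h), mob, mob,
    mobius_div _ _ _ _ _ (linear_ne_zero hX (right_ne_zero_of_det h))]
  simp only [map_add, map_mul]
  congr 1 <;> ring

theorem mobiusInverse_mob {a b c d : ℂ} (h : a * d - b * c ≠ 0) :
    MobiusInverse (mob a b c d) (mob d (-b) (-c) a) := by
  have scalar {k : ℂ} (hk : k ≠ 0) : mob k 0 0 k = RatFunc.X := by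
    have : (RatFunc.C k : RatFunc ℂ) ≠ 0 := (_root_.map_ne_zero _).2 hk
    simp only [mob, map_zero, add_zero, zero_mul, zero_add]
    field_simp
  have h' : d * a - -b * -c ≠ 0 := by convert h using 1; ring
  have h1 : comp (mob a b c d) (mob d (-b) (-c) a) = RatFunc.X := by
    rw [mob_comp_mob _ _ _ _ h', ← scalar h]
    congr 1 <;> ring
  have h2 : comp (mob d (-b) (-c) a) (mob a b c d) = RatFunc.X := by
    rw [mob_comp_mob _ _ _ _ h, ← scalar h]
    congr 1 <;> ring
  exact ⟨degree_eq_one_iff.2 ⟨_, h2⟩, degree_eq_one_iff.2 ⟨_, h1⟩, h1, h2⟩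

/-! ### The deck transformation of `M ∘ β²` -/

theorem MobiusInverse.left_cancel {M M' S T : RatFunc ℂ} (hM : MobiusInverse M M')
    (hS : degree S ≠ 0) (hT : degree T ≠ 0) (h : comp M S = comp M T) : S = T := by
  rw [← hM.symm.comp_cancel hS, h, hM.symm.comp_cancel hT]

/-- The involution which `β` conjugates to `z ↦ -z`, where `β'` is the inverse of `β`. -/
def deck (β β' : RatFunc ℂ) : RatFunc ℂ := comp β' (-β)

theorem comp_deck {β β' : RatFunc ℂ} (hβ : MobiusInverse β β') : comp β (deck β β') = -β :=
  hβ.comp_cancel (degree_neg_ne_zero hβ.degree_ne_zero)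

theorem degree_deck_ne_zero {β β' : RatFunc ℂ} (hβ : MobiusInverse β β') :
    degree (deck β β') ≠ 0 :=
  degree_comp_ne_zero hβ.symm.degree_ne_zero (degree_neg_ne_zero hβ.degree_ne_zero)

theorem deck_comp_deck {β β' : RatFunc ℂ} (hβ : MobiusInverse β β') :
    comp (deck β β') (deck β β') = RatFunc.X := by
  have hd := degree_deck_ne_zero hβ
  refine hβ.left_cancel (degree_comp_ne_zero hd hd) (by rw [degree_X]; exact one_ne_zero) ?_
  rw [← comp_assoc _ _ hd, comp_deck hβ, neg_comp _ hd, comp_deck hβ, neg_neg, comp_X]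

/-- Cancelling `M` in `A ∘ μ = A` leaves `(β ∘ μ)² = β²`. The sign `+` gives the identity, the sign
`-` gives `deck β β'`. -/
theorem isDeck_iff {M M' β β' : RatFunc ℂ} (hM : MobiusInverse M M') (hβ : MobiusInverse β β')
    (μ : RatFunc ℂ) : IsDeck (comp M (β ^ 2)) μ ↔ μ = deck β β' := by
  constructor
  · rintro ⟨h1, h2, h3⟩
    have hμ : degree μ ≠ 0 := by rw [h1]; exact one_ne_zero
    have hβμ := degree_comp_ne_zero hβ.degree_ne_zero hμ
    rw [comp_assoc _ _ hμ, sq_comp _ hμ] at h3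
    have h4 := hM.left_cancel (degree_sq_ne_zero hβμ) (degree_sq_ne_zero hβ.degree_ne_zero) h3
    rcases sq_eq_sq_iff_eq_or_eq_neg.1 h4 with h5 | h5
    · refine absurd ?_ h2
      rw [← hβ.symm.comp_cancel hμ, h5, hβ.2.2.2]
    · rw [← hβ.symm.comp_cancel hμ, h5, deck]
  · rintro rfl
    have hd := degree_deck_ne_zero hβ
    refine ⟨degree_eq_one_iff.2 ⟨_, deck_comp_deck hβ⟩, ?_, ?_⟩
    · intro h
      have := comp_deck hβ
      rw [h, comp_X] at this
      exact neg_ne_self_of_degree_ne_zero hβ.degree_ne_zero this.symm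
    · rw [comp_assoc _ _ hd, sq_comp _ hd, comp_deck hβ, neg_sq]

/-- If the matrix `(x, y; z, w)` of `β ∘ M` is generic, the curve `A(v) = μ(A(u))`, where
`A = M ∘ β²` and `μ` is its deck transformation, has no rational parametrization. -/
theorem comp_ne_deck_comp {M M' β β' : RatFunc ℂ} (hM : MobiusInverse M M')
    (hβ : MobiusInverse β β') {x y z w : ℂ} (hN : comp β M = mob x y z w)
    (hdet : x * w - y * z ≠ 0)
    (hx : x ≠ 0) (hy : y ≠ 0) (hz : z ≠ 0) (hw : w ≠ 0) (hs : x * w + y * z ≠ 0)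
    {U V : RatFunc ℂ} (hU : degree U ≠ 0) (hV : degree V ≠ 0) :
    comp (comp M (β ^ 2)) V ≠ comp (deck β β') (comp (comp M (β ^ 2)) U) := by
  intro h
  have hβU := degree_comp_ne_zero hβ.degree_ne_zero hU
  have hβV := degree_comp_ne_zero hβ.degree_ne_zero hV
  have hqU := degree_sq_ne_zero hβU
  have hqV := degree_sq_ne_zero hβV
  have hMU := degree_comp_ne_zero hM.degree_ne_zero hqU
  rw [comp_assoc _ _ hU, sq_comp _ hU, comp_assoc _ _ hV, sq_comp _ hV] at h
  -- In the coordinate `β` the deck transformation is negation. With `p = β(V)` and `q = β(U)` the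
  -- equation becomes `N(p²) = -N(q²)`, which is biquadratic after clearing denominators.
  have h1 := congrArg (comp β) h
  rw [← comp_assoc _ _ hMU, comp_deck hβ, neg_comp _ hMU, ← comp_assoc _ _ hqU,
    ← comp_assoc _ _ hqV, hN, mob_comp _ _ _ _ hqU, mob_comp _ _ _ _ hqV, ← neg_div,
    div_eq_div_iff (linear_ne_zero hqV (Or.inl hz)) (linear_ne_zero hqU (Or.inl hz))] at h1
  have h2xz : 2 * (x * z) ≠ 0 := mul_ne_zero two_ne_zero (mul_ne_zero hx hz)
  have h2yw : 2 * (y * w) ≠ 0 := mul_ne_zero two_ne_zero (mul_ne_zero hy hw)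
  refine hβU (degree_eq_zero_of_biquadratic (p := comp β V) h2xz hs h2yw ?_ ?_)
  · have : 2 * (x * z) * (2 * (y * w)) - (x * w + y * z) ^ 2 = -(x * w - y * z) ^ 2 := by ring
    rw [this]
    exact neg_ne_zero.2 (pow_ne_zero 2 hdet)
  · simp only [map_add, map_mul, map_ofNat]
    linear_combination h1

/-! ### Fields containing an iterate -/

/-- The conjugation of a quadratic extension `L(b)`, where `b ^ 2 ∈ L`. -/
theorem exists_quadratic_conj {L : IntermediateField ℂ (RatFunc ℂ)} {b : RatFunc ℂ}
    (hb2 : b ^ 2 ∈ L) (hb : b ∉ L) :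
    ∃ F : IntermediateField ℂ (RatFunc ℂ), L ≤ F ∧ b ∈ F ∧ ∃ τ : F →ₐ[ℂ] RatFunc ℂ,
      (∀ x : F, (x : RatFunc ℂ) ∈ L → τ x = x) ∧ ∀ x : F, (x : RatFunc ℂ) = b → τ x = -b := by
  have hirr : Irreducible (X ^ 2 - C (⟨b ^ 2, hb2⟩ : L)) := by
    refine X_pow_sub_C_irreducible_of_prime Nat.prime_two ?_
    intro c hc
    have hc' : (c : RatFunc ℂ) ^ 2 = b ^ 2 := congrArg Subtype.val hc
    rcases sq_eq_sq_iff_eq_or_eq_neg.1 hc' with h | h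
    · exact hb (h ▸ c.2)
    · exact hb (by rw [← neg_neg b, ← h]; exact neg_mem c.2)
  have hmon : (X ^ 2 - C (⟨b ^ 2, hb2⟩ : L)).Monic := monic_X_pow_sub_C _ two_ne_zero
  have heval (c : RatFunc ℂ) (hc : c ^ 2 = b ^ 2) :
      aeval c (X ^ 2 - C (⟨b ^ 2, hb2⟩ : L)) = 0 := by
    simp only [map_sub, map_pow, aeval_X, aeval_C, hc]
    exact sub_self _
  have hint : IsIntegral L b := ⟨_, hmon, heval b rfl⟩
  have hmin := minpoly.eq_of_irreducible_of_monic hirr (heval b rfl) hmon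
  -- The other root `-b` also lies in `ℂ(z)`, so the conjugation can take its values there.
  have hroot : -b ∈ (minpoly L b).aroots (RatFunc ℂ) := by
    rw [← hmin, mem_aroots]
    exact ⟨hmon.ne_zero, heval _ (neg_sq b)⟩
  let σ := (IntermediateField.algHomAdjoinIntegralEquiv L hint).symm ⟨-b, hroot⟩
  refine ⟨(IntermediateField.adjoin L {b}).restrictScalars ℂ, ?_, ?_, σ.restrictScalars ℂ, ?_, ?_⟩
  · intro x hx
    exact (IntermediateField.adjoin L {b}).algebraMap_mem ⟨x, hx⟩
  · exact IntermediateField.mem_adjoin_simple_self L b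
  · intro x hx
    exact σ.commutes ⟨x, hx⟩
  · intro x hx
    have : x = IntermediateField.AdjoinSimple.gen L b := Subtype.ext hx
    rw [this]
    exact IntermediateField.algHomAdjoinIntegralEquiv_symm_apply_gen L hint _

/-- The degree of `ℂ(z)` over `ℂ(A)` is the prime 2, so nothing lies strictly between them. -/
theorem eq_adjoin_of_degree_two {A : RatFunc ℂ} (hA : degree A = 2)
    {L : IntermediateField ℂ (RatFunc ℂ)} (hAL : A ∈ L) (hX : RatFunc.X ∉ L) :
    L = IntermediateField.adjoin ℂ {A} := by
  have hle : IntermediateField.adjoin ℂ {A} ≤ L := IntermediateField.adjoin_simple_le_iff.2 hAL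
  have h2 := (degree_eq_finrank A).symm.trans hA
  have : FiniteDimensional (IntermediateField.adjoin ℂ {A}) (RatFunc ℂ) :=
    FiniteDimensional.of_finrank_pos (by rw [h2]; exact two_pos)
  refine (IntermediateField.eq_of_le_of_finrank_eq' hle ?_).symm
  have hdvd := IntermediateField.finrank_dvd_of_le_left hle
  rw [h2] at hdvd ⊢
  rcases (Nat.dvd_prime Nat.prime_two).1 hdvd with h | h
  · rw [IntermediateField.finrank_eq_one_iff_eq_top] at h
    exact absurd (h ▸ IntermediateField.mem_top) hX
  · exact h.symm

/-- The functions invariant under `μ` form a field that contains `A` but not `z`, hence equal to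
`ℂ(A)`. -/
theorem exists_eq_comp_of_deck_invariant {A μ R : RatFunc ℂ} (hA : degree A = 2) (hμ : IsDeck A μ)
    (hR : comp R μ = R) : ∃ D, R = comp D A := by
  have hμ0 : degree μ ≠ 0 := by rw [hμ.1]; exact one_ne_zero
  let E : IntermediateField ℂ (RatFunc ℂ) :=
    { AlgHom.equalizer (compHom μ hμ0) (AlgHom.id ℂ _) with
      inv_mem' := by
        intro x (hx : compHom μ hμ0 x = x)
        change compHom μ hμ0 x⁻¹ = x⁻¹
        rw [map_inv₀, hx] }
  have hE {x : RatFunc ℂ} : x ∈ E ↔ comp x μ = x := by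
    rw [comp_eq_compHom _ hμ0]; exact Iff.rfl
  have := eq_adjoin_of_degree_two hA (hE.2 hμ.2.2) (fun h => hμ.2.1 (by rw [← hE.1 h, X_comp]))
  exact mem_adjoin_iff.1 (this ▸ hE.2 hR)

section Chain

variable {M M' β β' A : RatFunc ℂ}

/-- If `A(v) = μ(A(u))` has no non-constant solutions, where `A = M ∘ β²` and `μ` is its deck
transformation, then the fields between `ℂ(A^{∘n})` and `ℂ(z)` form the chain of the `ℂ(A^{∘j})`. -/
theorem eq_adjoin_iter (hM : MobiusInverse M M') (hβ : MobiusInverse β β')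
    (hA : A = comp M (β ^ 2)) (hdeg : degree A = 2)
    (hns : ∀ U V : RatFunc ℂ, degree U ≠ 0 → degree V ≠ 0 →
      comp A V ≠ comp (deck β β') (comp A U)) (n : ℕ) :
    ∀ L : IntermediateField ℂ (RatFunc ℂ), iter A (n + 1) ∈ L → iter A n ∉ L →
      L = IntermediateField.adjoin ℂ {iter A (n + 1)} := by
  have hA0 : degree A ≠ 0 := by rw [hdeg]; exact two_ne_zero
  induction n with
  | zero =>
    intro L h1 h0
    rw [iter_succ, iter_zero, comp_X] at h1 ⊢
    exact eq_adjoin_of_degree_two hdeg h1 h0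
  | succ n ih =>
    intro L h1 h0
    set w := iter A (n + 1) with hw
    have hw0 : degree w ≠ 0 := degree_iter_ne_zero hA0 _
    have hb0 := degree_comp_ne_zero hβ.degree_ne_zero hw0
    rw [iter_succ, ← hw] at h1 ⊢
    -- Here `β(w)² = M⁻¹(A(w))`.
    have hb2 : comp β w ^ 2 ∈ L := by
      rw [← hM.symm.comp_cancel (degree_sq_ne_zero hb0), ← sq_comp _ hw0, ← comp_assoc _ _ hw0, ← hA]
      exact comp_mem _ h1
    have hb : comp β w ∉ L := by
      intro h
      apply h0
      rw [← hβ.symm.comp_cancel hw0]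
      exact comp_mem _ h
    obtain ⟨F, hLF, hbF, τ, hτL, hτb⟩ := exists_quadratic_conj hb2 hb
    have hwF : w ∈ F := by
      rw [← hβ.symm.comp_cancel hw0]
      exact comp_mem _ hbF
    have hτw : τ ⟨w, hwF⟩ = comp (deck β β') w := by
      rw [map_comp_of_mem τ β' ⟨comp β w, hbF⟩ ⟨w, hwF⟩ (hβ.symm.comp_cancel hw0).symm,
        hτb _ rfl, deck, comp_assoc _ _ hw0, neg_comp _ hw0]
    -- If `u = A^{∘n}` lies in `F`, applying `τ` to `w = A(u)` gives `A(τ u) = μ(A(u))`, contrary to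
    -- `hns`. Otherwise the induction hypothesis applies to `F`.
    by_cases hu : iter A n ∈ F
    · exfalso
      have hτu : degree (τ ⟨_, hu⟩) ≠ 0 := by
        intro h
        obtain ⟨c, hc⟩ := degree_eq_zero_iff.1 h
        refine degree_iter_ne_zero hA0 n (degree_eq_zero_iff.2 ⟨c, ?_⟩)
        have h2 : τ ⟨_, hu⟩ = τ (algebraMap ℂ F c) := hc.trans (τ.commutes c).symm
        exact congrArg Subtype.val (τ.toRingHom.injective h2)
      refine hns (iter A n) _ (degree_iter_ne_zero hA0 n) hτu ?_
      rw [← map_comp_of_mem τ A ⟨_, hu⟩ ⟨w, hwF⟩ (iter_succ A n), hτw, hw, iter_succ]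
    · have hF := ih F hwF hu
      apply le_antisymm
      -- Write `t = R(w)`. It is fixed by `τ`, so `R(μ(w)) = R(w)`, and `w` can be cancelled.
      · intro t ht
        obtain ⟨R, rfl⟩ := mem_adjoin_iff.1 (hF ▸ hLF ht : t ∈ IntermediateField.adjoin ℂ {w})
        have h2 := hτL ⟨_, hLF ht⟩ ht
        rw [map_comp_of_mem τ R ⟨w, hwF⟩ ⟨_, hLF ht⟩ rfl, hτw, ← comp_assoc _ _ hw0] at h2
        obtain ⟨D, rfl⟩ := exists_eq_comp_of_deck_invariant hdeg
          (hA ▸ (isDeck_iff hM hβ _).2 rfl) (comp_right_injective hw0 h2)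
        rw [comp_assoc _ _ hw0]
        exact mem_adjoin_iff.2 ⟨D, rfl⟩
      · exact IntermediateField.adjoin_simple_le_iff.2 h1

end Chain

/-! ### From the chain of fields to decompositions -/

/-- Every field containing `A^{∘(n+1)}` but not `A^{∘n}` is generated by `A^{∘(n+1)}`. -/
def ChainProperty (A : RatFunc ℂ) : Prop :=
  ∀ (n : ℕ) (L : IntermediateField ℂ (RatFunc ℂ)), iter A (n + 1) ∈ L → iter A n ∉ L →
      L = IntermediateField.adjoin ℂ {iter A (n + 1)}

/-- Take the least `j` with `A^{∘j}` in `L`. Since all the generators are explicit, Lüroth's theorem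
is not needed. -/
theorem exists_iter_of_chain {A : RatFunc ℂ} (hch : ChainProperty A) {n : ℕ}
    {L : IntermediateField ℂ (RatFunc ℂ)} (h : iter A n ∈ L) :
    ∃ j ≤ n, L = IntermediateField.adjoin ℂ {iter A j} := by
  induction n with
  | zero =>
    refine ⟨0, le_rfl, ?_⟩
    rw [eq_top_of_X_mem h, iter_zero, RatFunc.adjoin_X]
  | succ n ih =>
    by_cases hn : iter A n ∈ L
    · obtain ⟨j, hj, hL⟩ := ih hn
      exact ⟨j, hj.trans (Nat.le_succ n), hL⟩
    · exact ⟨n + 1, le_rfl, hch n L h hn⟩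

theorem degree_eq_one_of_comp {B ρ ρ' : RatFunc ℂ} (hρ : MobiusInverse ρ ρ') (hB : degree B ≠ 0)
    (h : degree (comp B ρ) = 1) : degree B = 1 := by
  obtain ⟨S, hS⟩ := degree_eq_one_iff.1 h
  have h1 : comp S B = ρ' := by
    have := congrArg (fun T => comp T ρ') hS
    simp only [X_comp] at this
    rw [comp_assoc _ _ hρ.symm.degree_ne_zero, hρ.cancel_comp] at this
    exact this
  refine degree_eq_one_iff.2 ⟨comp ρ S, ?_⟩
  rw [comp_assoc _ _ hB, h1, hρ.2.2.1]

/-- The Möbius transformation `ρ` makes the induction work: splitting off the first factor `B = ν ∘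
A ∘ ρ` leaves a decomposition of a lower iterate composed with `ν⁻¹`. -/
theorem decomposition_iter {A : RatFunc ℂ} (hdeg : degree A = 2) (hch : ChainProperty A)
    (L : List (RatFunc ℂ)) : ∀ (n : ℕ) (ρ ρ' : RatFunc ℂ), MobiusInverse ρ ρ' →
    (∀ B ∈ L, Indecomposable B) → compList L = comp (iter A n) ρ →
    L.length = n ∧ ∃ μ ν : ℕ → RatFunc ℂ,
      (∀ i, MobiusInverse (μ i) (ν i)) ∧ μ 0 = ρ ∧ μ L.length = RatFunc.X ∧
      ∀ (i : ℕ) (hi : i < L.length), L[i] = comp (ν (i + 1)) (comp A (μ i)) := by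
  have hA0 : degree A ≠ 0 := by rw [hdeg]; exact two_ne_zero
  induction L with
  | nil =>
    intro n ρ ρ' hρ _ h
    have h' : RatFunc.X = comp (iter A n) ρ := h
    cases n with
    | zero =>
      rw [iter_zero, X_comp] at h'
      subst h'
      exact ⟨rfl, fun _ => RatFunc.X, fun _ => RatFunc.X, fun _ => mobiusInverse_X, rfl, rfl,
        fun i hi => absurd hi (Nat.not_lt_zero i)⟩
    | succ n =>
      have h1 : degree (comp A ρ) = 1 := degree_eq_one_iff.2 ⟨iter A n, by
        rw [h', iter_succ' hA0, comp_assoc _ _ hρ.degree_ne_zero]⟩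
      have := degree_eq_one_of_comp hρ hA0 h1
      omega
  | cons B L ih =>
    intro n ρ ρ' hρ hind h
    have hB := hind B (List.mem_cons_self)
    have hB0 : degree B ≠ 0 := by have := hB.1; omega
    have hρ0 := hρ.degree_ne_zero
    have hρ0' := hρ.symm.degree_ne_zero
    change comp (compList L) B = _ at h
    have h1 : comp (compList L) (comp B ρ') = iter A n := by
      rw [← comp_assoc _ _ hρ0', h, hρ.cancel_comp]
    obtain ⟨j, -, hj⟩ := exists_iter_of_chain hch (n := n)
      (L := IntermediateField.adjoin ℂ {comp B ρ'}) (mem_adjoin_iff.2 ⟨_, h1.symm⟩)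
    have hBj : comp B ρ' ∈ IntermediateField.adjoin ℂ {iter A j} :=
      hj ▸ IntermediateField.mem_adjoin_simple_self ℂ _
    cases j with
    | zero =>
      exfalso
      have h2 : degree (comp B ρ') = 1 := by
        rw [degree_eq_finrank, hj, ← degree_eq_finrank, iter_zero, degree_X]
      have := degree_eq_one_of_comp hρ.symm hB0 h2
      have := hB.1
      omega
    | succ j =>
      obtain ⟨D, hD⟩ := mem_adjoin_iff.1 hBj
      rw [iter_succ' hA0, ← comp_assoc _ _ hA0] at hD
      set ν := comp D (iter A j) with hν
      have hBν : B = comp ν (comp A ρ) := by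
        rw [← comp_assoc _ _ hρ0, ← hD, hρ.symm.cancel_comp]
      -- `B` is indecomposable and `A ∘ ρ` does not have degree one.
      have hν1 : degree ν = 1 := by
        rcases hB.2 _ _ hBν with h2 | h2
        · exact h2
        · have := degree_eq_one_of_comp hρ hA0 h2
          omega
      obtain ⟨ν', hνν'⟩ := exists_mobiusInverse hν1
      rw [hD, ← comp_assoc _ _ hA0] at h1
      cases n with
      | zero =>
        rw [iter_zero] at h1
        have := degree_eq_one_iff.2 ⟨_, h1⟩
        omega
      | succ n =>
        rw [iter_succ' hA0] at h1
        have h2 : compList L = comp (iter A n) ν' := by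
          rw [← comp_right_injective hA0 h1, hνν'.cancel_comp]
        obtain ⟨hlen, μs, νs, hinv, h0, hend, hfac⟩ := ih n ν' ν hνν'.symm
          (fun C hC => hind C (List.mem_cons_of_mem _ hC)) h2
        -- At index 1 the inverse is taken to be `ν` itself rather than `νs 0`, since `B = ν ∘ A ∘
        -- ρ` is the factorization at hand.
        refine ⟨by rw [List.length_cons, hlen], fun i => Nat.casesOn i ρ μs,
          fun i => Nat.casesOn i ρ' (fun k => Nat.casesOn k ν fun l => νs (l + 1)), ?_, rfl, hend, ?_⟩
        · rintro (_ | _ | i)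
          · exact hρ
          · change MobiusInverse (μs 0) ν
            rw [h0]; exact hνν'.symm
          · exact hinv (i + 1)
        · rintro (_ | i) hi
          · exact hBν
          · exact hfac i (by simpa using hi)

theorem noNontrivialDecomp_of_chain {A : RatFunc ℂ} (hdeg : degree A = 2) (hch : ChainProperty A) :
    NoNontrivialDecomp A := by
  intro n _ L hL h
  obtain ⟨hlen, μ, ν, hinv, h0, hend, hfac⟩ := decomposition_iter hdeg hch L n _ _ mobiusInverse_X hL
    (by rw [h, comp_X])
  refine ⟨by rw [hlen, List.length_replicate], μ, ν, hinv, h0, hend, fun i hi => ?_⟩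
  rw [hfac i hi, List.getElem_replicate]

/-! ### Simultaneous diagonalization of numerator and denominator -/

/-- The resultant of two binary quadratic forms in terms of the coefficients. -/
theorem resultant_two_two (P Q : ℂ[X]) :
    resultant P Q 2 2 = (P.coeff 2 * Q.coeff 0 - P.coeff 0 * Q.coeff 2) ^ 2 -
      (P.coeff 2 * Q.coeff 1 - P.coeff 1 * Q.coeff 2) *
      (P.coeff 1 * Q.coeff 0 - P.coeff 0 * Q.coeff 1) := by
  rw [resultant, Matrix.det_succ_row_zero]
  simp [sylvester, Matrix.det_fin_three, Fin.sum_univ_succ, Fin.succAbove, Fin.addCases, Matrix.submatrix]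
  ring

theorem resultant_ne_zero_of_isCoprime {P Q : ℂ[X]} (h : IsCoprime P Q)
    (hd : max P.natDegree Q.natDegree = 2) : resultant P Q 2 2 ≠ 0 := by
  have key : ∀ {P Q : ℂ[X]}, IsCoprime P Q → P.natDegree = 2 → Q.natDegree ≤ 2 →
      resultant P Q 2 2 ≠ 0 := by
    intro P Q h hP hQ
    have hne := resultant_ne_zero P Q h
    obtain ⟨k, hk⟩ := Nat.exists_eq_add_of_le hQ
    rw [hP] at hne
    -- Raising the formal degree of `Q` to 2 only multiplies the resultant by a power of the leading
    -- coefficient of `P`.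
    have h1 := resultant_add_right_deg (f := P) (g := Q) (m := 2) (n := Q.natDegree) k le_rfl
    rw [← hk] at h1
    rw [h1]
    refine mul_ne_zero (pow_ne_zero _ ?_) hne
    rw [← hP]
    exact leadingCoeff_ne_zero.2 (by rintro rfl; simp at hP)
  rcases max_choice P.natDegree Q.natDegree with h1 | h1
  · exact key h (by omega) (by omega)
  · rw [resultant_comm]
    exact mul_ne_zero (by norm_num) (key h.symm (by omega) (by omega))

/-- `P = a l₁² + b l₂²` and `Q = c l₁² + d l₂²`, where `l₁ = e z + f` and `l₂ = g z + h`. -/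
structure SquareForm (P Q : ℂ[X]) (a b c d e f g h : ℂ) : Prop where
  left : P = C a * (C e * X + C f) ^ 2 + C b * (C g * X + C h) ^ 2
  right : Q = C c * (C e * X + C f) ^ 2 + C d * (C g * X + C h) ^ 2
  det_outer : a * d - b * c ≠ 0
  det_inner : e * h - f * g ≠ 0

theorem exists_binary_quadratic_factorization (E F G : ℂ) :
    ∃ e f g h : ℂ, e * g = E ∧ e * h + f * g = 2 * F ∧ f * h = G := by
  by_cases hE : E = 0
  · exact ⟨0, 1, 2 * F, G, by simp [hE], by ring, by ring⟩
  · obtain ⟨s, hs⟩ := IsAlgClosed.exists_pow_nat_eq (F ^ 2 - E * G) two_pos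
    refine ⟨1, (F + s) / E, E, F - s, by ring, by field_simp; ring, ?_⟩
    field_simp
    linear_combination -hs

/-- The Jacobian `P'Q - PQ'` has discriminant four times the resultant, so it splits as `l₁ l₂` with
independent `l₁`, `l₂`. Both forms are apolar to it (`hp`, `hq`), and the forms apolar to `l₁ l₂`
are the combinations of `l₁²` and `l₂²`. -/
theorem exists_squareForm_coeffs {p₀ p₁ p₂ q₀ q₁ q₂ : ℂ}
    (hR : (p₂ * q₀ - p₀ * q₂) ^ 2 - (p₂ * q₁ - p₁ * q₂) * (p₁ * q₀ - p₀ * q₁) ≠ 0) :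
    ∃ a b c d e f g h : ℂ,
      p₂ = a * e ^ 2 + b * g ^ 2 ∧ p₁ = 2 * (a * e * f + b * g * h) ∧ p₀ = a * f ^ 2 + b * h ^ 2 ∧
      q₂ = c * e ^ 2 + d * g ^ 2 ∧ q₁ = 2 * (c * e * f + d * g * h) ∧ q₀ = c * f ^ 2 + d * h ^ 2 ∧
      a * d - b * c ≠ 0 ∧ e * h - f * g ≠ 0 := by
  obtain ⟨e, f, g, h, hE, hF, hG⟩ := exists_binary_quadratic_factorization
    (p₂ * q₁ - p₁ * q₂) (p₂ * q₀ - p₀ * q₂) (p₁ * q₀ - p₀ * q₁)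
  have hD : (e * h - f * g) ^ 2 ≠ 0 := by
    have : (e * h - f * g) ^ 2 = 4 * ((p₂ * q₀ - p₀ * q₂) ^ 2 -
        (p₂ * q₁ - p₁ * q₂) * (p₁ * q₀ - p₀ * q₁)) := by
      rw [← hE, ← hG]
      linear_combination (e * h + f * g + 2 * (p₂ * q₀ - p₀ * q₂)) * hF
    rw [this]
    exact mul_ne_zero (by norm_num) hR
  have hΔ : e * h - f * g ≠ 0 := fun h0 => hD (by rw [h0]; ring)
  have hp : p₂ * (f * h) * 2 - p₁ * (e * h + f * g) + 2 * p₀ * (e * g) = 0 := by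
    rw [hE, hF, hG]; ring
  have hq : q₂ * (f * h) * 2 - q₁ * (e * h + f * g) + 2 * q₀ * (e * g) = 0 := by
    rw [hE, hF, hG]; ring
  have main : ∀ {p₀ p₁ p₂ : ℂ}, p₂ * (f * h) * 2 - p₁ * (e * h + f * g) + 2 * p₀ * (e * g) = 0 →
      ∃ a b : ℂ, p₂ = a * e ^ 2 + b * g ^ 2 ∧ p₁ = 2 * (a * e * f + b * g * h) ∧
        p₀ = a * f ^ 2 + b * h ^ 2 := by
    intro p₀ p₁ p₂ hp
    obtain ⟨k, hk⟩ : ∃ k, k * (e * h - f * g) ^ 2 = 1 := ⟨_, inv_mul_cancel₀ hD⟩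
    -- The coefficient of `l₁²` is found by evaluating at the zero of `l₂`, and conversely.
    refine ⟨k * (p₂ * h ^ 2 - p₁ * h * g + p₀ * g ^ 2),
      k * (p₂ * f ^ 2 - p₁ * f * e + p₀ * e ^ 2), ?_, ?_, ?_⟩
    · linear_combination (-e * g * k) * hp - p₂ * hk
    · linear_combination (-(e * h + f * g) * k) * hp - p₁ * hk
    · linear_combination (-f * h * k) * hp - p₀ * hk
  obtain ⟨a, b, h2, h1, h0⟩ := main hp
  obtain ⟨c, d, k2, k1, k0⟩ := main hq
  refine ⟨a, b, c, d, e, f, g, h, h2, h1, h0, k2, k1, k0, ?_, hΔ⟩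
  intro hdet
  apply hR
  rw [h2, h1, h0, k2, k1, k0]
  have hb : b * c = a * d := by linear_combination -hdet
  -- The resultant equals `(ad - bc)² (eh - fg)⁴`.
  linear_combination (a * d - b * c) * (e * h - f * g) ^ 4 * hdet

theorem exists_squareForm {P Q : ℂ[X]} (hP : P.natDegree ≤ 2) (hQ : Q.natDegree ≤ 2)
    (hR : resultant P Q 2 2 ≠ 0) : ∃ a b c d e f g h : ℂ, SquareForm P Q a b c d e f g h := by
  rw [resultant_two_two] at hR
  obtain ⟨a, b, c, d, e, f, g, h, h2, h1, h0, k2, k1, k0, hM, hβ⟩ := exists_squareForm_coeffs hR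
  have key : ∀ {P : ℂ[X]} {a b : ℂ}, P.natDegree ≤ 2 → P.coeff 2 = a * e ^ 2 + b * g ^ 2 →
      P.coeff 1 = 2 * (a * e * f + b * g * h) → P.coeff 0 = a * f ^ 2 + b * h ^ 2 →
      P = C a * (C e * X + C f) ^ 2 + C b * (C g * X + C h) ^ 2 := by
    intro P a b hP h2 h1 h0
    rw [P.as_sum_range_C_mul_X_pow' (n := 3) (by omega)]
    simp only [Finset.sum_range_succ, Finset.sum_range_zero, h0, h1, h2, map_add, map_mul, map_pow,
      map_ofNat]
    ring
  exact ⟨a, b, c, d, e, f, g, h, key hP h2 h1 h0, key hQ k2 k1 k0, hM, hβ⟩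

theorem exists_squareForm_of_degree {A : RatFunc ℂ} (hA : degree A = 2) :
    ∃ a b c d e f g h : ℂ, SquareForm A.num A.denom a b c d e f g h :=
  exists_squareForm ((le_max_left _ _).trans hA.le) ((le_max_right _ _).trans hA.le)
    (resultant_ne_zero_of_isCoprime A.isCoprime_num_denom hA)

namespace SquareForm

variable {P Q : ℂ[X]} {A : RatFunc ℂ} {a b c d e f g h : ℂ}

theorem coeff_sq_combination (s t e f g h : ℂ) :
    (C s * (C e * X + C f) ^ 2 + C t * (C g * X + C h) ^ 2).coeff 2 = s * e ^ 2 + t * g ^ 2 ∧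
    (C s * (C e * X + C f) ^ 2 + C t * (C g * X + C h) ^ 2).coeff 1 =
      2 * (s * e * f + t * g * h) ∧
    (C s * (C e * X + C f) ^ 2 + C t * (C g * X + C h) ^ 2).coeff 0 = s * f ^ 2 + t * h ^ 2 := by
  have : C s * (C e * X + C f) ^ 2 + C t * (C g * X + C h) ^ 2 =
      C (s * e ^ 2 + t * g ^ 2) * X ^ 2 + C (2 * (s * e * f + t * g * h)) * X +
        C (s * f ^ 2 + t * h ^ 2) := by
    simp only [map_add, map_mul, map_pow, map_ofNat]
    ring
  rw [this]
  generalize s * e ^ 2 + t * g ^ 2 = u₂, 2 * (s * e * f + t * g * h) = u₁,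
    s * f ^ 2 + t * h ^ 2 = u₀
  refine ⟨?_, ?_, ?_⟩ <;> simp [coeff_X, coeff_C, coeff_X_pow]

theorem natDegree_sq_combination_le (s t e f g h : ℂ) :
    (C s * (C e * X + C f) ^ 2 + C t * (C g * X + C h) ^ 2).natDegree ≤ 2 := by
  compute_degree

theorem swap (H : SquareForm P Q a b c d e f g h) : SquareForm P Q b a d c g h e f where
  left := by rw [H.left, add_comm]
  right := by rw [H.right, add_comm]
  det_outer h0 := H.det_outer (by linear_combination -h0)
  det_inner h0 := H.det_inner (by linear_combination -h0)

theorem isCoprime (H : SquareForm P Q a b c d e f g h) : IsCoprime P Q := by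
  rw [H.left, H.right]
  refine isCoprime_sq_combination ?_ H.det_outer
  refine ⟨C ((e * h - f * g)⁻¹) * -C g, C ((e * h - f * g)⁻¹) * C e, ?_⟩
  have hk : C ((e * h - f * g)⁻¹) * (C e * C h - C f * C g) = 1 := by
    rw [← C_mul, ← C_mul, ← C_sub, ← C_mul, inv_mul_cancel₀ H.det_inner, C_1]
  linear_combination hk

theorem max_natDegree (H : SquareForm P Q a b c d e f g h) :
    max P.natDegree Q.natDegree = 2 := by
  apply le_antisymm
  · rw [H.left, H.right]
    exact max_le (natDegree_sq_combination_le ..) (natDegree_sq_combination_le ..)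
  · by_contra hlt
    rw [not_le, max_lt_iff] at hlt
    have h1 := coeff_eq_zero_of_natDegree_lt hlt.1
    have h2 := coeff_eq_zero_of_natDegree_lt hlt.2
    rw [H.left, (coeff_sq_combination ..).1] at h1
    rw [H.right, (coeff_sq_combination ..).1] at h2
    have he : e = 0 := by
      have : (a * d - b * c) * e ^ 2 = 0 := by linear_combination d * h1 - b * h2
      simpa [H.det_outer] using this
    have hg : g = 0 := by
      have : (a * d - b * c) * g ^ 2 = 0 := by linear_combination a * h2 - c * h1
      simpa [H.det_outer] using this
    exact H.det_inner (by rw [he, hg]; ring)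

theorem eq_comp (H : SquareForm A.num A.denom a b c d e f g h) :
    A = comp (mob a b c d) (mob e f g h ^ 2) := by
  have hX : degree (RatFunc.X : RatFunc ℂ) ≠ 0 := by rw [degree_X]; exact one_ne_zero
  have hl := linear_ne_zero hX (right_ne_zero_of_det H.det_inner)
  conv_lhs => rw [← RatFunc.num_div_denom A, H.left, H.right]
  rw [mob_comp _ _ _ _ (degree_sq_ne_zero (degree_mob_ne_zero H.det_inner)), mob, div_pow,
    mobius_div _ _ _ _ _ (pow_ne_zero 2 hl)]
  simp only [map_add, map_mul, map_pow, RatFunc.algebraMap_C, RatFunc.algebraMap_X]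

end SquareForm

/-! ### Homogeneous coordinates on the sphere -/

open Classical in
/-- The point `x / y` of the Riemann sphere with homogeneous coordinates `(x : y)`. -/
def pt (x y : ℂ) : OnePoint ℂ := if y = 0 then OnePoint.infty else ((x / y : ℂ) : OnePoint ℂ)

theorem pt_mul_left {k : ℂ} (hk : k ≠ 0) (x y : ℂ) : pt (k * x) (k * y) = pt x y := by
  simp only [pt, mul_eq_zero, hk, false_or, mul_div_mul_left _ _ hk]

theorem pt_zero_right (x : ℂ) : pt x 0 = OnePoint.infty := by simp [pt]

theorem pt_eq_iff {x y x' y' : ℂ} (h : x ≠ 0 ∨ y ≠ 0) (h' : x' ≠ 0 ∨ y' ≠ 0) :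
    pt x y = pt x' y' ↔ x * y' = x' * y := by
  by_cases hy : y = 0 <;> by_cases hy' : y' = 0
  · simp [pt, hy, hy']
  · have hx : x ≠ 0 := by simpa [hy] using h
    simp [pt, hy, hy', hx]
  · have hx : x' ≠ 0 := by simpa [hy'] using h'
    simp [pt, hy, hy', hx]
  · simp [pt, hy, hy', div_eq_div_iff]

theorem toMap_coe (A : RatFunc ℂ) (z : ℂ) :
    toMap A (z : OnePoint ℂ) = pt (A.num.eval z) (A.denom.eval z) := rfl

theorem toMap_infty (A : RatFunc ℂ) :
    toMap A OnePoint.infty = pt (A.num.coeff (degree A)) (A.denom.coeff (degree A)) := rfl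

/-- Treats finite and infinite values alike; the factor `k` changes neither degrees nor root
multiplicities. -/
theorem exists_fiberPoly_pt (A : RatFunc ℂ) {s t : ℂ} (h : s ≠ 0 ∨ t ≠ 0) :
    ∃ k : ℂ, k ≠ 0 ∧ fiberPoly A (pt s t) = C k * (C t * A.num - C s * A.denom) := by
  by_cases ht : t = 0
  · have hs : s ≠ 0 := by simpa [ht] using h
    refine ⟨-s⁻¹, neg_ne_zero.2 (inv_ne_zero hs), ?_⟩
    have hk : C s⁻¹ * C s = (1 : ℂ[X]) := by rw [← C_mul, inv_mul_cancel₀ hs, C_1]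
    have : fiberPoly A (pt s t) = A.denom := by rw [ht, pt_zero_right]; rfl
    rw [this, ht, C_neg, C_0]
    linear_combination -A.denom * hk
  · refine ⟨t⁻¹, inv_ne_zero ht, ?_⟩
    have hk : C t⁻¹ * C t = (1 : ℂ[X]) := by rw [← C_mul, inv_mul_cancel₀ ht, C_1]
    have : fiberPoly A (pt s t) = A.num - C (s / t) * A.denom := by
      rw [pt, if_neg ht]; rfl
    rw [this, div_eq_mul_inv, C_mul]
    linear_combination -A.num * hk

/-- Numerator and denominator in lowest terms are unique up to a common constant. -/
theorem exists_num_denom_eq {P Q : ℂ[X]} (h : IsCoprime P Q) (hQ : Q ≠ 0) :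
    ∃ k : ℂ, k ≠ 0 ∧
      (algebraMap ℂ[X] (RatFunc ℂ) P / algebraMap ℂ[X] (RatFunc ℂ) Q).num = C k * P ∧
      (algebraMap ℂ[X] (RatFunc ℂ) P / algebraMap ℂ[X] (RatFunc ℂ) Q).denom = C k * Q := by
  set A := algebraMap ℂ[X] (RatFunc ℂ) P / algebraMap ℂ[X] (RatFunc ℂ) Q with hA
  have hdd : A.denom ∣ Q := RatFunc.denom_div_dvd P Q
  have hcross : A.num * Q = P * A.denom := (RatFunc.num_mul_eq_mul_denom_iff hQ).2 hA
  have hdd' : Q ∣ A.denom := h.symm.dvd_of_dvd_mul_left ⟨A.num, by rw [← hcross, mul_comm]⟩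
  obtain ⟨u, hu⟩ := associated_of_dvd_dvd hdd' hdd
  obtain ⟨k, hk, hku⟩ := isUnit_iff.1 u.isUnit
  refine ⟨k, hk.ne_zero, ?_, ?_⟩
  · apply mul_right_cancel₀ hQ
    rw [hcross, ← hu, hku]
    ring
  · rw [← hu, hku, mul_comm]

theorem mob_eq_div (a b c d : ℂ) : mob a b c d =
    algebraMap ℂ[X] (RatFunc ℂ) (C a * X + C b) / algebraMap ℂ[X] (RatFunc ℂ) (C c * X + C d) := by
  simp only [mob, map_add, map_mul, RatFunc.algebraMap_C, RatFunc.algebraMap_X]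

theorem isCoprime_linear {a b c d : ℂ} (h : a * d - b * c ≠ 0) :
    IsCoprime (C a * X + C b) (C c * X + C d) := by
  refine ⟨C ((a * d - b * c)⁻¹) * -C c, C ((a * d - b * c)⁻¹) * C a, ?_⟩
  have hk : C ((a * d - b * c)⁻¹) * (C a * C d - C b * C c) = 1 := by
    rw [← C_mul, ← C_mul, ← C_sub, ← C_mul, inv_mul_cancel₀ h, C_1]
  linear_combination hk

theorem toMap_mob {a b c d : ℂ} (h : a * d - b * c ≠ 0) {x y : ℂ} (hxy : x ≠ 0 ∨ y ≠ 0) :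
    toMap (mob a b c d) (pt x y) = pt (a * x + b * y) (c * x + d * y) := by
  have hQ : (C c * X + C d : ℂ[X]) ≠ 0 := by
    intro h0
    have h1 : (C c * X + C d : ℂ[X]).coeff 1 = 0 := by rw [h0, coeff_zero]
    have h2 : (C c * X + C d : ℂ[X]).coeff 0 = 0 := by rw [h0, coeff_zero]
    simp at h1 h2
    exact h (by rw [h1, h2]; ring)
  obtain ⟨k, hk, hnum, hden⟩ := exists_num_denom_eq (isCoprime_linear h) hQ
  rw [← mob_eq_div] at hnum hden
  by_cases hy : y = 0
  · have hx : x ≠ 0 := by simpa [hy] using hxy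
    rw [hy, pt_zero_right, toMap_infty, (mobiusInverse_mob h).1, hnum, hden, coeff_C_mul, coeff_C_mul,
      pt_mul_left hk, mul_zero, mul_zero, add_zero, add_zero, mul_comm a, mul_comm c, pt_mul_left hx]
    simp
  · rw [pt, if_neg hy, toMap_coe, hnum, hden]
    simp only [eval_mul, eval_add, eval_C, eval_X]
    rw [pt_mul_left hk, ← pt_mul_left hy]
    congr 1 <;> field_simp

/-- At a double root the form and its derivative vanish. If `u` and `v` were nonzero, both linear
forms would vanish there, contrary to their independence. -/
theorem eq_zero_or_eq_zero_of_sq_dvd {u v e f g h z : ℂ} (hΔ : e * h - f * g ≠ 0)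
    (hdvd : (X - C z) ^ 2 ∣ C u * (C e * X + C f) ^ 2 + C v * (C g * X + C h) ^ 2) :
    u = 0 ∨ v = 0 := by
  obtain ⟨q, hq⟩ := hdvd
  have h0 : u * (e * z + f) ^ 2 + v * (g * z + h) ^ 2 = 0 := by
    have := congrArg (eval z) hq
    simpa using this
  have h1 : u * e * (e * z + f) + v * g * (g * z + h) = 0 := by
    have := congrArg (fun p => eval z (derivative p)) hq
    simp only [sq, derivative_mul, derivative_add, derivative_sub, derivative_C, derivative_X,
      eval_add, eval_mul, eval_sub, eval_C, eval_X] at this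
    simp at this
    linear_combination this / 2
  by_contra! hcon
  have hx : e * z + f = 0 := by
    have : (e * h - f * g) * u * (e * z + f) = 0 := by
      linear_combination (g * z + h) * h1 - g * h0
    simpa [hΔ, hcon.1] using this
  have hy : g * z + h = 0 := by
    have : (e * h - f * g) * v * (g * z + h) = 0 := by
      linear_combination e * h0 - (e * z + f) * h1
    simpa [hΔ, hcon.2] using this
  exact hΔ (by linear_combination e * hy - g * hx)

/-! ### Critical values and the disjointness condition -/

namespace SquareForm

variable {A : RatFunc ℂ} {a b c d e f g h : ℂ}

theorem degree_eq_two (H : SquareForm A.num A.denom a b c d e f g h) : degree A = 2 :=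
  H.max_natDegree

theorem left_ne_zero (H : SquareForm A.num A.denom a b c d e f g h) : a ≠ 0 ∨ c ≠ 0 := by
  by_contra! hcon
  exact H.det_outer (by rw [hcon.1, hcon.2]; ring)

theorem right_ne_zero (H : SquareForm A.num A.denom a b c d e f g h) : b ≠ 0 ∨ d ≠ 0 :=
  H.swap.left_ne_zero

theorem exists_fiberPoly (H : SquareForm A.num A.denom a b c d e f g h) {s t : ℂ}
    (hst : s ≠ 0 ∨ t ≠ 0) : ∃ k : ℂ, k ≠ 0 ∧ fiberPoly A (pt s t) =
      C k * (C (t * a - s * c) * (C e * X + C f) ^ 2 + C (t * b - s * d) * (C g * X + C h) ^ 2) := by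
  obtain ⟨k, hk, hf⟩ := exists_fiberPoly_pt A hst
  refine ⟨k, hk, ?_⟩
  rw [hf, H.left, H.right]
  simp only [map_sub, map_mul]
  ring

theorem pt_mem_of_fiber (H : SquareForm A.num A.denom a b c d e f g h) {s t : ℂ}
    (hst : s ≠ 0 ∨ t ≠ 0) (h0 : t * a - s * c = 0 ∨ t * b - s * d = 0) :
    pt s t = pt a c ∨ pt s t = pt b d := by
  rcases h0 with h0 | h0
  · exact Or.inl ((pt_eq_iff hst H.left_ne_zero).2 (by linear_combination -h0))
  · exact Or.inr ((pt_eq_iff hst H.right_ne_zero).2 (by linear_combination -h0))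

/-- The critical point is the zero of `g z + h`, which is `∞` when `g = 0`: the fibre polynomial
over `(a : c)` is a multiple of `(g z + h)²`. -/
theorem mem_criticalValues (H : SquareForm A.num A.denom a b c d e f g h) :
    pt a c ∈ criticalValues A := by
  by_cases hg : g = 0
  · have he : e ≠ 0 := by rintro rfl; exact H.det_inner (by rw [hg]; ring)
    have hval : toMap A OnePoint.infty = pt a c := by
      rw [toMap_infty, H.degree_eq_two, H.left, H.right, (coeff_sq_combination ..).1,
        (coeff_sq_combination ..).1, hg, ← pt_mul_left (pow_ne_zero 2 he) a c]
      congr 1 <;> ring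
    refine ⟨OnePoint.infty, ?_, hval⟩
    change 2 ≤ degree A - (fiberPoly A (toMap A OnePoint.infty)).natDegree
    obtain ⟨k, hk, hf⟩ := H.exists_fiberPoly H.left_ne_zero
    have hconst : fiberPoly A (pt a c) = C (k * (c * b - a * d) * h ^ 2) := by
      rw [hf, hg, show c * a - a * c = 0 by ring]
      simp only [map_mul, map_pow, C_0]
      ring
    rw [hval, hconst, natDegree_C, H.degree_eq_two]
  · obtain ⟨z, hz⟩ : ∃ z, g * z + h = 0 := ⟨-h / g, by field_simp; ring⟩
    have hx : e * z + f ≠ 0 := by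
      intro hx
      exact H.det_inner (by linear_combination e * hz - g * hx)
    have hval : toMap A (z : OnePoint ℂ) = pt a c := by
      rw [toMap_coe, H.left, H.right]
      simp only [eval_add, eval_mul, eval_pow, eval_C, eval_X, hz]
      rw [← pt_mul_left (pow_ne_zero 2 hx) a c]
      congr 1 <;> ring
    refine ⟨(z : OnePoint ℂ), ?_, hval⟩
    change 2 ≤ (fiberPoly A (toMap A (z : OnePoint ℂ))).rootMultiplicity z
    obtain ⟨k, hk, hf⟩ := H.exists_fiberPoly H.left_ne_zero
    have hsq : fiberPoly A (pt a c) = C (k * (c * b - a * d) * g ^ 2) * (X - C z) ^ 2 := by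
      have hh : (C h : ℂ[X]) = -(C g * C z) := by
        rw [← C_mul, ← C_neg]; congr 1; linear_combination hz
      rw [hf, hh, show c * a - a * c = 0 by ring]
      simp only [map_mul, map_pow, C_0]
      ring
    have hk' : k * (c * b - a * d) * g ^ 2 ≠ 0 :=
      mul_ne_zero (mul_ne_zero hk fun h0 => H.det_outer (by linear_combination -h0))
        (pow_ne_zero 2 hg)
    rw [hval, hsq]
    refine (le_rootMultiplicity_iff (mul_ne_zero (C_ne_zero.2 hk') (pow_ne_zero 2
      (X_sub_C_ne_zero z)))).2 (dvd_mul_left _ _)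

theorem criticalValues_eq (H : SquareForm A.num A.denom a b c d e f g h) :
    criticalValues A = {pt a c, pt b d} := by
  apply Set.Subset.antisymm
  · rintro _ ⟨z, hz, rfl⟩
    rw [Set.mem_insert_iff, Set.mem_singleton_iff]
    induction z using OnePoint.rec with
    | infty =>
      change 2 ≤ degree A - (fiberPoly A (toMap A OnePoint.infty)).natDegree at hz
      rw [toMap_infty, H.degree_eq_two] at hz ⊢
      have hst : A.num.coeff 2 ≠ 0 ∨ A.denom.coeff 2 ≠ 0 := by
        by_contra! hcon
        have h1 : A.num.natDegree ≠ 2 := fun h1 => by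
          have := leadingCoeff_eq_zero.1 (show A.num.leadingCoeff = 0 by
            rw [leadingCoeff, h1]; exact hcon.1)
          rw [this] at h1; simp at h1
        have h2 : A.denom.natDegree ≠ 2 := fun h2 => by
          have := leadingCoeff_eq_zero.1 (show A.denom.leadingCoeff = 0 by
            rw [leadingCoeff, h2]; exact hcon.2)
          rw [this] at h2; simp at h2
        have := H.max_natDegree
        omega
      obtain ⟨k, hk, hf⟩ := H.exists_fiberPoly hst
      refine H.pt_mem_of_fiber hst ?_
      rw [hf, natDegree_C_mul hk] at hz
      set u := A.denom.coeff 2 * a - A.num.coeff 2 * c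
      set v := A.denom.coeff 2 * b - A.num.coeff 2 * d
      -- Multiplicity two at `∞` leaves a constant fibre polynomial; its coefficients at `z²` and
      -- `z` then play the role of the value and the derivative at a finite point.
      have hnd : (C u * (C e * X + C f) ^ 2 + C v * (C g * X + C h) ^ 2).natDegree = 0 := by omega
      have h2 := coeff_eq_zero_of_natDegree_lt (hnd.trans_lt two_pos)
      have h1 := coeff_eq_zero_of_natDegree_lt (hnd.trans_lt one_pos)
      rw [(coeff_sq_combination ..).1] at h2
      rw [(coeff_sq_combination ..).2.1] at h1
      by_contra! hcon
      have he : e = 0 := by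
        have : (e * h - f * g) * u * e = 0 := by linear_combination h * h2 - g * h1 / 2
        simpa [H.det_inner, hcon.1] using this
      have hg : g = 0 := by
        have : (e * h - f * g) * v * g = 0 := by linear_combination e * h1 / 2 - f * h2
        simpa [H.det_inner, hcon.2] using this
      exact H.det_inner (by rw [he, hg]; ring)
    | coe z =>
      change 2 ≤ (fiberPoly A (toMap A (z : OnePoint ℂ))).rootMultiplicity z at hz
      rw [toMap_coe] at hz ⊢
      have hst : A.num.eval z ≠ 0 ∨ A.denom.eval z ≠ 0 := by
        by_contra! hcon
        obtain ⟨x, y, hxy⟩ := A.isCoprime_num_denom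
        have := congrArg (eval z) hxy
        simp [hcon.1, hcon.2] at this
      obtain ⟨k, hk, hf⟩ := H.exists_fiberPoly hst
      refine H.pt_mem_of_fiber hst ?_
      refine eq_zero_or_eq_zero_of_sq_dvd (z := z) H.det_inner ?_
      have hdvd := (pow_dvd_pow (X - C z) hz).trans (pow_rootMultiplicity_dvd _ z)
      rw [hf] at hdvd
      exact (isUnit_C.2 hk.isUnit).dvd_mul_left.1 hdvd
  · rintro _ (rfl | rfl)
    · exact H.mem_criticalValues
    · exact H.swap.mem_criticalValues

theorem deck_eq_mob (hΔ : e * h - f * g ≠ 0) :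
    deck (mob e f g h) (mob h (-f) (-g) e) =
      mob (-(h * e + f * g)) (-(2 * f * h)) (2 * e * g) (h * e + f * g) := by
  have : -mob e f g h = mob (-e) (-f) g h := by
    simp only [mob, map_neg]
    rw [← neg_div]
    ring
  rw [deck, this, mob_comp_mob _ _ _ _ (by intro h0; exact hΔ (by linear_combination -h0))]
  congr 1 <;> ring

theorem isDeck_iff_eq_mob (H : SquareForm A.num A.denom a b c d e f g h) (μ : RatFunc ℂ) :
    IsDeck A μ ↔
      μ = mob (-(h * e + f * g)) (-(2 * f * h)) (2 * e * g) (h * e + f * g) := by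
  conv_lhs => rw [H.eq_comp]
  rw [isDeck_iff (mobiusInverse_mob H.det_outer) (mobiusInverse_mob H.det_inner),
    deck_eq_mob H.det_inner]

/-- The equation is `β(x' : y') = -β(x : y)` with denominators cleared. -/
theorem deck_pt_eq_iff (H : SquareForm A.num A.denom a b c d e f g h) {x y x' y' : ℂ}
    (hxy : x ≠ 0 ∨ y ≠ 0) (hxy' : x' ≠ 0 ∨ y' ≠ 0) :
    toMap (mob (-(h * e + f * g)) (-(2 * f * h)) (2 * e * g) (h * e + f * g)) (pt x y) = pt x' y' ↔
      (e * x + f * y) * (g * x' + h * y') + (g * x + h * y) * (e * x' + f * y') = 0 := by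
  have hdet : -(h * e + f * g) * (h * e + f * g) - -(2 * f * h) * (2 * e * g) ≠ 0 := by
    have : -(h * e + f * g) * (h * e + f * g) - -(2 * f * h) * (2 * e * g) =
      -(e * h - f * g) ^ 2 := by ring
    rw [this]
    exact neg_ne_zero.2 (pow_ne_zero 2 H.det_inner)
  rw [toMap_mob hdet hxy, pt_eq_iff _ hxy']
  · constructor <;> intro h0 <;> linear_combination -h0
  · by_contra! hcon
    rcases hxy with hx | hy
    · have : (-(h * e + f * g) * (h * e + f * g) - -(2 * f * h) * (2 * e * g)) * x = 0 := by
        linear_combination (h * e + f * g) * hcon.1 + 2 * f * h * hcon.2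
      exact (mul_ne_zero hdet hx) this
    · have : (-(h * e + f * g) * (h * e + f * g) - -(2 * f * h) * (2 * e * g)) * y = 0 := by
        linear_combination -(h * e + f * g) * hcon.2 - 2 * e * g * hcon.1
      exact (mul_ne_zero hdet hy) this

/-- The critical values are disjoint from their image under the deck transformation exactly if the
matrix of the composition of the inner and the outer Möbius transformation is generic. -/
theorem disjoint_iff (H : SquareForm A.num A.denom a b c d e f g h) :
    (toMap (mob (-(h * e + f * g)) (-(2 * f * h)) (2 * e * g) (h * e + f * g)) ''
        criticalValues A) ∩ criticalValues A = ∅ ↔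
      (e * a + f * c ≠ 0 ∧ g * a + h * c ≠ 0) ∧ (e * b + f * d ≠ 0 ∧ g * b + h * d ≠ 0) ∧
      (e * a + f * c) * (g * b + h * d) + (e * b + f * d) * (g * a + h * c) ≠ 0 := by
  have h1 := H.left_ne_zero
  have h2 := H.right_ne_zero
  rw [H.criticalValues_eq, Set.image_pair, ← Set.disjoint_iff_inter_eq_empty]
  simp only [Set.disjoint_insert_left, Set.disjoint_singleton_left, Set.mem_insert_iff,
    Set.mem_singleton_iff, H.deck_pt_eq_iff h1 h1, H.deck_pt_eq_iff h1 h2, H.deck_pt_eq_iff h2 h1,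
    H.deck_pt_eq_iff h2 h2, not_or]
  -- The two conditions that `μ` fixes no critical value give the four entries; the two conditions
  -- that it does not exchange them coincide.
  constructor
  · rintro ⟨⟨h11, h12⟩, -, h22⟩
    refine ⟨⟨?_, ?_⟩, ⟨?_, ?_⟩, fun h0 => h12 (by linear_combination h0)⟩
    · exact fun h0 => h11 (by rw [h0]; ring)
    · exact fun h0 => h11 (by rw [h0]; ring)
    · exact fun h0 => h22 (by rw [h0]; ring)
    · exact fun h0 => h22 (by rw [h0]; ring)
  · rintro ⟨⟨hx, hz⟩, ⟨hy, hw⟩, hs⟩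
    refine ⟨⟨?_, fun h0 => hs (by linear_combination h0)⟩,
      fun h0 => hs (by linear_combination h0), ?_⟩
    · exact fun h0 => mul_ne_zero two_ne_zero (mul_ne_zero hx hz) (by linear_combination h0)
    · exact fun h0 => mul_ne_zero two_ne_zero (mul_ne_zero hy hw) (by linear_combination h0)

end SquareForm

/-! ### Uniqueness of the deck transformation and the criterion -/

theorem existsUnique_deck {A : RatFunc ℂ} (hA : degree A = 2) :
    (∃! μ : RatFunc ℂ, IsDeck A μ) ∧ ∀ μ : RatFunc ℂ, IsDeck A μ → comp μ μ = RatFunc.X := by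
  obtain ⟨a, b, c, d, e, f, g, h, H⟩ := exists_squareForm_of_degree hA
  have hM := mobiusInverse_mob H.det_outer
  have hβ := mobiusInverse_mob H.det_inner
  rw [H.eq_comp]
  refine ⟨⟨_, (isDeck_iff hM hβ _).2 rfl, fun μ hμ => (isDeck_iff hM hβ μ).1 hμ⟩, fun μ hμ => ?_⟩
  rw [(isDeck_iff hM hβ μ).1 hμ, deck_comp_deck hβ]

theorem noNontrivialDecomp_of_disjoint {A μ : RatFunc ℂ} (hA : degree A = 2) (hμ : IsDeck A μ)
    (hdisj : (toMap μ '' criticalValues A) ∩ criticalValues A = ∅) : NoNontrivialDecomp A := by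
  obtain ⟨a, b, c, d, e, f, g, h, H⟩ := exists_squareForm_of_degree hA
  rw [(H.isDeck_iff_eq_mob μ).1 hμ] at hdisj
  obtain ⟨⟨hx, hz⟩, ⟨hy, hw⟩, hs⟩ := H.disjoint_iff.1 hdisj
  have hM := mobiusInverse_mob H.det_outer
  have hβ := mobiusInverse_mob H.det_inner
  refine noNontrivialDecomp_of_chain hA (eq_adjoin_iter hM hβ H.eq_comp hA fun U V hU hV => ?_)
  rw [H.eq_comp]
  refine comp_ne_deck_comp hM hβ (mob_comp_mob _ _ _ _ H.det_outer) ?_ hx hy hz hw hs hU hV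
  intro h0
  exact mul_ne_zero H.det_inner H.det_outer (by linear_combination h0)

/-! ### The Zariski open set -/

theorem SquareForm.smul {P Q : ℂ[X]} {a b c d e f g h : ℂ} (H : SquareForm P Q a b c d e f g h)
    {k : ℂ} (hk : k ≠ 0) :
    SquareForm (C k * P) (C k * Q) (k * a) (k * b) (k * c) (k * d) e f g h where
  left := by rw [H.left, C_mul, C_mul]; ring
  right := by rw [H.right, C_mul, C_mul]; ring
  det_outer h0 := mul_ne_zero (pow_ne_zero 2 hk) H.det_outer (by linear_combination h0)
  det_inner := H.det_inner

/-- For `P = p₀ + p₁ z + p₂ z²` and `Q = q₀ + q₁ z + q₂ z²`, the apolar invariant of the quadratic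
forms of the critical points and of the critical values of `P / Q`. -/
def apolarInvariant {R : Type*} [CommRing R] (p₀ p₁ p₂ q₀ q₁ q₂ : R) : R :=
  (p₂ * q₁ - p₁ * q₂) * (p₁ ^ 2 - 4 * (p₀ * p₂))
    - (p₂ * q₀ - p₀ * q₂) * (4 * (p₀ * q₂ + p₂ * q₀) - 2 * (p₁ * q₁))
    + (p₁ * q₀ - p₀ * q₁) * (q₁ ^ 2 - 4 * (q₀ * q₂))

/-- The resultant of the quadratic forms of the critical points and of the critical values. -/
def criticalResultant {R : Type*} [CommRing R] (p₀ p₁ p₂ q₀ q₁ q₂ : R) : R :=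
  ((p₂ * q₁ - p₁ * q₂) * (p₁ ^ 2 - 4 * (p₀ * p₂))
      - (p₁ * q₀ - p₀ * q₁) * (q₁ ^ 2 - 4 * (q₀ * q₂))) ^ 2
    - ((p₂ * q₁ - p₁ * q₂) * (4 * (p₀ * q₂ + p₂ * q₀) - 2 * (p₁ * q₁))
        - 2 * (p₂ * q₀ - p₀ * q₂) * (q₁ ^ 2 - 4 * (q₀ * q₂)))
      * (2 * (p₂ * q₀ - p₀ * q₂) * (p₁ ^ 2 - 4 * (p₀ * p₂))
        - (p₁ * q₀ - p₀ * q₁) * (4 * (p₀ * q₂ + p₂ * q₀) - 2 * (p₁ * q₁)))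

/-- The critical points are the zero and the pole of `β`. Apolarity makes the critical values
harmonic with respect to them: `β` takes opposite values there, so `μ` exchanges the critical
values. -/
theorem apolarInvariant_squareForm (a b c d e f g h : ℂ) :
    apolarInvariant (a * f ^ 2 + b * h ^ 2) (2 * (a * e * f + b * g * h)) (a * e ^ 2 + b * g ^ 2)
      (c * f ^ 2 + d * h ^ 2) (2 * (c * e * f + d * g * h)) (c * e ^ 2 + d * g ^ 2) =
    -4 * (a * d - b * c) * (e * h - f * g) ^ 3 *
      ((e * a + f * c) * (g * b + h * d) + (e * b + f * d) * (g * a + h * c)) := by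
  rw [apolarInvariant]
  ring

/-- This vanishes when a critical value is also a critical point, that is, a fixed point of `μ`. -/
theorem criticalResultant_squareForm (a b c d e f g h : ℂ) :
    criticalResultant (a * f ^ 2 + b * h ^ 2) (2 * (a * e * f + b * g * h)) (a * e ^ 2 + b * g ^ 2)
      (c * f ^ 2 + d * h ^ 2) (2 * (c * e * f + d * g * h)) (c * e ^ 2 + d * g ^ 2) =
    64 * (a * d - b * c) ^ 2 * (e * h - f * g) ^ 6 *
      (((e * a + f * c) * (g * a + h * c)) * ((e * b + f * d) * (g * b + h * d))) := by
  rw [criticalResultant]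
  ring

theorem SquareForm.generic {P Q : ℂ[X]} {a b c d e f g h : ℂ} (H : SquareForm P Q a b c d e f g h)
    (h1 : apolarInvariant (P.coeff 0) (P.coeff 1) (P.coeff 2) (Q.coeff 0) (Q.coeff 1) (Q.coeff 2)
      ≠ 0)
    (h2 : criticalResultant (P.coeff 0) (P.coeff 1) (P.coeff 2) (Q.coeff 0) (Q.coeff 1) (Q.coeff 2)
      ≠ 0) :
    (e * a + f * c ≠ 0 ∧ g * a + h * c ≠ 0) ∧ (e * b + f * d ≠ 0 ∧ g * b + h * d ≠ 0) ∧
      (e * a + f * c) * (g * b + h * d) + (e * b + f * d) * (g * a + h * c) ≠ 0 := by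
  obtain ⟨p2, p1, p0⟩ := coeff_sq_combination a b e f g h
  obtain ⟨q2, q1, q0⟩ := coeff_sq_combination c d e f g h
  rw [← H.left] at p2 p1 p0
  rw [← H.right] at q2 q1 q0
  rw [p0, p1, p2, q0, q1, q2, apolarInvariant_squareForm] at h1
  rw [p0, p1, p2, q0, q1, q2, criticalResultant_squareForm] at h2
  have h3 := right_ne_zero_of_mul h2
  exact ⟨mul_ne_zero_iff.1 (left_ne_zero_of_mul h3), mul_ne_zero_iff.1 (right_ne_zero_of_mul h3),
    right_ne_zero_of_mul h1⟩

theorem coeff_coeffPoly (v : Fin 2 × Fin 3 → ℂ) (j : Fin 2) :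
    (coeffPoly v j).coeff 0 = v (j, 0) ∧ (coeffPoly v j).coeff 1 = v (j, 1) ∧
      (coeffPoly v j).coeff 2 = v (j, 2) := by
  refine ⟨?_, ?_, ?_⟩ <;>
    simp [coeffPoly, Fin.sum_univ_three, coeff_X, coeff_C, coeff_X_pow]

theorem natDegree_coeffPoly_le (v : Fin 2 × Fin 3 → ℂ) (j : Fin 2) :
    (coeffPoly v j).natDegree ≤ 2 := by
  rw [coeffPoly]
  exact natDegree_sum_le_of_forall_le _ _ fun k _ =>
    (natDegree_C_mul_X_pow_le _ _).trans (by omega)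

/-- The equation of the complement of the open set on which the critical values and their images
under the deck transformation are disjoint. -/
def excludedPoly : MvPolynomial (Fin 2 × Fin 3) ℂ :=
  apolarInvariant (MvPolynomial.X (0, 0)) (MvPolynomial.X (0, 1)) (MvPolynomial.X (0, 2))
    (MvPolynomial.X (1, 0)) (MvPolynomial.X (1, 1)) (MvPolynomial.X (1, 2)) *
  criticalResultant (MvPolynomial.X (0, 0)) (MvPolynomial.X (0, 1)) (MvPolynomial.X (0, 2))
    (MvPolynomial.X (1, 0)) (MvPolynomial.X (1, 1)) (MvPolynomial.X (1, 2))

theorem eval_excludedPoly (v : Fin 2 × Fin 3 → ℂ) :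
    MvPolynomial.eval v excludedPoly =
      apolarInvariant (v (0, 0)) (v (0, 1)) (v (0, 2)) (v (1, 0)) (v (1, 1)) (v (1, 2)) *
      criticalResultant (v (0, 0)) (v (0, 1)) (v (0, 2)) (v (1, 0)) (v (1, 1)) (v (1, 2)) := by
  simp [excludedPoly, apolarInvariant, criticalResultant]

/-- The two factors have degrees 4 and 8. -/
theorem isHomogeneous_excludedPoly : excludedPoly.IsHomogeneous 12 := by
  have hm (i j k l : Fin 2 × Fin 3) : (MvPolynomial.X i * MvPolynomial.X j -
      MvPolynomial.X k * MvPolynomial.X l : MvPolynomial (Fin 2 × Fin 3) ℂ).IsHomogeneous 2 :=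
    ((MvPolynomial.isHomogeneous_X ℂ i).mul (MvPolynomial.isHomogeneous_X ℂ j)).sub
      ((MvPolynomial.isHomogeneous_X ℂ k).mul (MvPolynomial.isHomogeneous_X ℂ l))
  have hn (r : ℕ) [r.AtLeastTwo] {p : MvPolynomial (Fin 2 × Fin 3) ℂ} {n : ℕ}
      (hp : p.IsHomogeneous n) : (OfNat.ofNat r * p).IsHomogeneous n := by
    have := (MvPolynomial.isHomogeneous_C (Fin 2 × Fin 3) (OfNat.ofNat r : ℂ)).mul hp
    rwa [zero_add, map_ofNat] at this
  have hX (i : Fin 2 × Fin 3) := MvPolynomial.isHomogeneous_X ℂ i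
  have hd (i j k : Fin 2 × Fin 3) : (MvPolynomial.X i ^ 2 - 4 * (MvPolynomial.X j *
      MvPolynomial.X k) : MvPolynomial (Fin 2 × Fin 3) ℂ).IsHomogeneous 2 :=
    ((hX i).pow 2).sub (hn 4 ((hX j).mul (hX k)))
  have hc := (hn 4 (((hX (0, 0)).mul (hX (1, 2))).add ((hX (0, 2)).mul (hX (1, 0))))).sub
    (hn 2 ((hX (0, 1)).mul (hX (1, 1))))
  have h1 := (((hm (0, 2) (1, 1) (0, 1) (1, 2)).mul (hd (0, 1) (0, 0) (0, 2))).sub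
    ((hm (0, 2) (1, 0) (0, 0) (1, 2)).mul hc)).add
    ((hm (0, 1) (1, 0) (0, 0) (1, 1)).mul (hd (1, 1) (1, 0) (1, 2)))
  have h2 := ((((hm (0, 2) (1, 1) (0, 1) (1, 2)).mul (hd (0, 1) (0, 0) (0, 2))).sub
    ((hm (0, 1) (1, 0) (0, 0) (1, 1)).mul (hd (1, 1) (1, 0) (1, 2)))).pow 2).sub
    ((((hm (0, 2) (1, 1) (0, 1) (1, 2)).mul hc).sub
      ((hn 2 (hm (0, 2) (1, 0) (0, 0) (1, 2))).mul (hd (1, 1) (1, 0) (1, 2)))).mul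
    (((hn 2 (hm (0, 2) (1, 0) (0, 0) (1, 2))).mul (hd (0, 1) (0, 0) (0, 2))).sub
      ((hm (0, 1) (1, 0) (0, 0) (1, 1)).mul hc)))
  exact h1.mul h2

theorem disjoint_of_eval_ne_zero {x : CoeffSpace 2} (hx : x ∈ RatVar 2)
    (hF : MvPolynomial.eval x.rep excludedPoly ≠ 0) :
    degree (toRatFunc x) = 2 ∧ ∀ μ : RatFunc ℂ, IsDeck (toRatFunc x) μ →
      (toMap μ '' criticalValues (toRatFunc x)) ∩ criticalValues (toRatFunc x) = ∅ := by
  obtain ⟨a, b, c, d, e, f, g, h, H⟩ := exists_squareForm (natDegree_coeffPoly_le x.rep 0)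
    (natDegree_coeffPoly_le x.rep 1) hx
  have hQ : coeffPoly x.rep 1 ≠ 0 := by
    intro h0
    refine hx ?_
    rw [h0, resultant_zero_right]
    simp
  obtain ⟨k, hk, hnum, hden⟩ := exists_num_denom_eq H.isCoprime hQ
  have H' := H.smul hk
  rw [← hnum, ← hden] at H'
  change SquareForm (toRatFunc x).num (toRatFunc x).denom _ _ _ _ _ _ _ _ at H'
  refine ⟨H'.degree_eq_two, fun μ hμ => ?_⟩
  rw [(H'.isDeck_iff_eq_mob μ).1 hμ, H'.disjoint_iff]
  rw [eval_excludedPoly] at hF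
  obtain ⟨p0, p1, p2⟩ := coeff_coeffPoly x.rep 0
  obtain ⟨q0, q1, q2⟩ := coeff_coeffPoly x.rep 1
  obtain ⟨⟨h1, h2⟩, ⟨h3, h4⟩, h5⟩ := H.generic
    (by rw [p0, p1, p2, q0, q1, q2]; exact left_ne_zero_of_mul hF)
    (by rw [p0, p1, p2, q0, q1, q2]; exact right_ne_zero_of_mul hF)
  have key : ∀ {s t : ℂ} (u v : ℂ), u * s + v * t ≠ 0 → u * (k * s) + v * (k * t) ≠ 0 :=
    fun u v hne h0 => mul_ne_zero hk hne (by linear_combination h0)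
  exact ⟨⟨key _ _ h1, key _ _ h2⟩, ⟨key _ _ h3, key _ _ h4⟩,
    fun h0 => mul_ne_zero (pow_ne_zero 2 hk) h5 (by linear_combination h0)⟩

/-- For `β = z` the conditions concern the matrix of `M` alone: nonzero entries, determinant and
permanent. -/
theorem nonempty_ratVar_diff : (RatVar 2 \ projZeros {excludedPoly}).Nonempty := by
  -- the function `(2 z ^ 2 + 1) / (z ^ 2 + 1)`
  let v : Fin 2 × Fin 3 → ℂ := fun i => ![![1, 0, 2], ![1, 0, 1]] i.1 i.2
  have hv : v ≠ 0 := fun h0 => by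
    have := congrFun h0 (0, 0)
    simp [v] at this
  -- The chosen representative is only a multiple `r • v`; homogeneity makes the factor harmless.
  obtain ⟨r, hr⟩ := Projectivization.exists_smul_eq_mk_rep ℂ v hv
  set x := Projectivization.mk ℂ v hv with hxdef
  have hr0 : (r : ℂ) ≠ 0 := r.ne_zero
  have hrep (i : Fin 2 × Fin 3) : x.rep i = r * v i := by rw [← hr]; rfl
  refine ⟨x, ?_, ?_⟩
  · change resultant _ _ 2 2 ≠ 0
    obtain ⟨p0, p1, p2⟩ := coeff_coeffPoly x.rep 0
    obtain ⟨q0, q1, q2⟩ := coeff_coeffPoly x.rep 1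
    rw [resultant_two_two, p0, p1, p2, q0, q1, q2]
    simp only [hrep, v, Matrix.cons_val]
    intro h0
    exact pow_ne_zero 4 hr0 (by linear_combination h0)
  · intro hmem
    have h0 := hmem _ (Set.mem_singleton _)
    rw [eval_excludedPoly] at h0
    simp only [hrep, v, Matrix.cons_val, apolarInvariant, criticalResultant] at h0
    ring_nf at h0
    simp at h0

end RationalMap

end

theorem theorem3p7 :
    -- a function of degree two has exactly one deck transformation, and it is an involution
    (∀ A : RatFunc ℂ, RationalMap.degree A = 2 →
      (∃! μ : RatFunc ℂ, RationalMap.IsDeck A μ) ∧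
      ∀ μ : RatFunc ℂ, RationalMap.IsDeck A μ → RationalMap.comp μ μ = RatFunc.X) ∧
    -- the criterion
    (∀ A μ : RatFunc ℂ, RationalMap.degree A = 2 → RationalMap.IsDeck A μ →
      (RationalMap.toMap μ '' RationalMap.criticalValues A) ∩ RationalMap.criticalValues A = ∅ →
      RationalMap.NoNontrivialDecomp A) ∧
    -- the criterion applies on a nonempty Zariski open set
    (∃ U : Set (RationalMap.CoeffSpace 2), RationalMap.IsZariskiOpenInRatVar U ∧ U.Nonempty ∧
      ∀ x ∈ U,
        (∀ μ : RatFunc ℂ, RationalMap.IsDeck (RationalMap.toRatFunc x) μ →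
          (RationalMap.toMap μ '' RationalMap.criticalValues (RationalMap.toRatFunc x)) ∩
            RationalMap.criticalValues (RationalMap.toRatFunc x) = ∅) ∧
        RationalMap.NoNontrivialDecomp (RationalMap.toRatFunc x)) := by
  refine ⟨fun A hA => RationalMap.existsUnique_deck hA,
    fun A μ hA hμ hdisj => RationalMap.noNontrivialDecomp_of_disjoint hA hμ hdisj,
    _, ⟨{RationalMap.excludedPoly}, ?_, rfl⟩, RationalMap.nonempty_ratVar_diff, ?_⟩
  · rintro p rfl
    exact ⟨12, RationalMap.isHomogeneous_excludedPoly⟩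
  · rintro x ⟨hx, hF⟩
    obtain ⟨hdeg, hdisj⟩ := RationalMap.disjoint_of_eval_ne_zero hx fun h0 => hF (by
      rintro p rfl
      exact h0)
    refine ⟨hdisj, ?_⟩
    obtain ⟨μ, hμ, -⟩ := (RationalMap.existsUnique_deck hdeg).1
    exact RationalMap.noNontrivialDecomp_of_disjoint hdeg hμ (hdisj μ hμ)
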